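/- Let $U'$ and $U$ be connected (Hausdorff, second countable) complex manifolds and let $\eta\colon U'\to U$ be a finite surjective holomorphic map, i.e. $\eta$ is holomorphic, proper, surjective and has finite fibres. A distribution on $U$ is a coherent subsheaf $W\subset T_U$ of the holomorphic tangent sheaf which is saturated, i.e. $T_U/W$ is torsion-free. For a distribution $W\subset T_U$ let $Q\subset\Omega_U$ be the kernel of the natural map $\Omega_U\to W^*$, let $Q^{sat}\subset\Omega_{U'}$ be the saturation of the image of $\eta^*Q\to\eta^*\Omega_U\to\Omega_{U'}$ (the sheaf of $1$-forms $\omega$ such that locally $f\omega$ lies in this image for some holomorphic function $f$ which does not vanish identically on any nonempty open set), put $S:=\Omega_{U'}/Q^{sat}$, and define the lifting of $W$ to be $\eta^{-1}W:=S^*\subset T_{U'}$, i.e. the sheaf of holomorphic vector fields on open subsets of $U'$ that are annihilated by $Q^{sat}$. Let $W_1,W_2\subset T_U$ be distributions. If $$T_{U'}=\eta^{-1}W_1\oplus\eta^{-1}W_2,$$ then $$T_U=W_1\oplus W_2.$$ (Both are equalities of sheaves: internal direct sums of subsheaves.) -/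

import Mathlib

open Bundle TopologicalSpace
open scoped Manifold ContDiff

/-- The model of an `n`-dimensional complex manifold (without boundary): `ℂⁿ`. -/
noncomputable abbrev modelC (n : ℕ) :
    ModelWithCorners ℂ (EuclideanSpace ℂ (Fin n)) (EuclideanSpace ℂ (Fin n)) :=
  modelWithCornersSelf ℂ (EuclideanSpace ℂ (Fin n))

section Functions

variable {n : ℕ} {M : Type*} [TopologicalSpace M] [ChartedSpace (EuclideanSpace ℂ (Fin n)) M]

/-- `f` is a holomorphic function on the open set `V`, i.e. `f ∈ 𝒪_M(V)`. (The values of `f`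
outside `V` are irrelevant.) -/
def IsHolFun (V : Opens M) (f : M → ℂ) : Prop :=
  ContMDiffOn (modelC n) (modelWithCornersSelf ℂ ℂ) ω f V

/-- `f` does not vanish identically on any nonempty open subset of `V`; for a holomorphic `f` on
`V` this says that the germ of `f` at each point `x ∈ V` is a nonzero element (that is, a
nonzerodivisor) of the local ring `𝒪_{M,x}`. -/
def NowhereLocallyZero (V : Opens M) (f : M → ℂ) : Prop :=
  ∀ O : Opens M, O ≤ V → (O : Set M).Nonempty → ∃ x ∈ O, f x ≠ 0

end Functions

section Sheaves

variable {n : ℕ} {M : Type*} [TopologicalSpace M] [ChartedSpace (EuclideanSpace ℂ (Fin n)) M]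
  (F : Type*) [NormedAddCommGroup F] [NormedSpace ℂ F]
  (E : M → Type*) [TopologicalSpace (TotalSpace F E)] [∀ x, TopologicalSpace (E x)]
  [FiberBundle F E]

/-- `s` is a holomorphic section over the open set `V` of the bundle `E` with model fibre `F`.
(The values of `s` outside `V` are irrelevant.) -/
def IsHolSection (V : Opens M) (s : Π x, E x) : Prop :=
  ContMDiffOn (modelC n) ((modelC n).prod (modelWithCornersSelf ℂ F)) ω
    (fun x => TotalSpace.mk' F x (s x)) V

variable {F E} in
theorem IsHolSection.of_locally {V : Opens M} {s : Π x, E x}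
    (h : ∀ x ∈ V, ∃ V' ≤ V, x ∈ V' ∧ ∃ t, IsHolSection (n := n) F E V' t ∧ ∀ y ∈ V', s y = t y) :
    IsHolSection (n := n) F E V s := by
  intro x hx
  obtain ⟨V', -, hxV', t, ht, hst⟩ := h x hx
  have h1 := (ht x hxV').contMDiffAt (V'.isOpen.mem_nhds hxV')
  refine (h1.congr_of_eventuallyEq ?_).contMDiffWithinAt
  filter_upwards [V'.isOpen.mem_nhds hxV'] with y hy
  rw [hst y hy]

variable {F E} in
theorem IsHolSection.mono {V V' : Opens M} {s : Π x, E x} (hs : IsHolSection (n := n) F E V s)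
    (h : V' ≤ V) : IsHolSection (n := n) F E V' s :=
  ContMDiffOn.mono hs h

variable [∀ x, AddCommGroup (E x)] [∀ x, Module ℂ (E x)]

/-- A subsheaf of `𝒪_M`-modules of the sheaf of holomorphic sections of the bundle `E`:
for each open `V` a set `sec V` of holomorphic sections over `V` which is an `𝒪_M(V)`-submodule,
compatible with restriction, and such that a section belonging locally to the subsheaf belongs to
it. Sections over `V` are represented by functions on all of `M`, of which only the values on `V`
matter (this is part of `mem_of_locally`). -/
structure ModuleSubsheaf where
  sec : Opens M → Set (Π x, E x)
  isHol : ∀ {V s}, s ∈ sec V → IsHolSection (n := n) F E V s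
  zero_mem : ∀ V, (0 : Π x, E x) ∈ sec V
  add_mem : ∀ {V s t}, s ∈ sec V → t ∈ sec V → s + t ∈ sec V
  smul_mem : ∀ {V f s}, IsHolFun (n := n) V f → s ∈ sec V → (fun x => f x • s x) ∈ sec V
  restrict : ∀ {V V' s}, V' ≤ V → s ∈ sec V → s ∈ sec V'
  mem_of_locally : ∀ {V s},
    (∀ x ∈ V, ∃ V' ≤ V, x ∈ V' ∧ ∃ t ∈ sec V', ∀ y ∈ V', s y = t y) → s ∈ sec V

variable {F E}

namespace ModuleSubsheaf

/-- The subsheaf `G` of the sheaf `ℰ` of sections of `E` is saturated: `ℰ / G` is torsion-free. -/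
def IsSaturated (G : ModuleSubsheaf (n := n) F E) : Prop :=
  ∀ (V : Opens M) (f : M → ℂ) (s : Π x, E x), IsHolFun (n := n) V f → NowhereLocallyZero V f →
    IsHolSection (n := n) F E V s → (fun x => f x • s x) ∈ G.sec V → s ∈ G.sec V

/-- The subsheaf `G` is of finite type: locally there are finitely many sections of `G` generating
`G`. As `G` is a subsheaf of a locally free sheaf of finite rank, this is equivalent to `G` being a
coherent sheaf (Oka's theorem). -/
def IsFiniteType (G : ModuleSubsheaf (n := n) F E) : Prop :=
  ∀ x : M, ∃ V : Opens M, x ∈ V ∧ ∃ (k : ℕ) (g : Fin k → Π x, E x), (∀ i, g i ∈ G.sec V) ∧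
    ∀ V' ≤ V, ∀ s ∈ G.sec V', ∀ y ∈ V', ∃ V'' ≤ V', y ∈ V'' ∧
      ∃ f : Fin k → M → ℂ, (∀ i, IsHolFun (n := n) V'' (f i)) ∧
        ∀ z ∈ V'', s z = ∑ i, f i z • g i z

/-- The sheaf `ℰ` of sections of `E` is the (internal) direct sum of its subsheaves `G₁`, `G₂`:
over each open set, every section of `ℰ` is the sum of a section of `G₁` and one of `G₂`, and
`G₁ ∩ G₂ = 0`. -/
def IsDirectSum (G₁ G₂ : ModuleSubsheaf (n := n) F E) : Prop :=
  ∀ V : Opens M,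
    (∀ s : Π x, E x, IsHolSection (n := n) F E V s →
      ∃ s₁ ∈ G₁.sec V, ∃ s₂ ∈ G₂.sec V, ∀ x ∈ V, s x = s₁ x + s₂ x) ∧
    (∀ s ∈ G₁.sec V ∩ G₂.sec V, ∀ x ∈ V, s x = 0)

end ModuleSubsheaf

theorem IsHolFun.mono {V V' : Opens M} {f : M → ℂ} (hf : IsHolFun (n := n) V f)
    (h : V' ≤ V) : IsHolFun (n := n) V' f :=
  ContMDiffOn.mono hf h

theorem IsHolFun.mul {V : Opens M} {f g : M → ℂ} (hf : IsHolFun (n := n) V f)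
    (hg : IsHolFun (n := n) V g) : IsHolFun (n := n) V (fun x => f x * g x) :=
  ContMDiffOn.mul hf hg

theorem NowhereLocallyZero.mono {V V' : Opens M} {f : M → ℂ} (hf : NowhereLocallyZero V f)
    (h : V' ≤ V) : NowhereLocallyZero V' f :=
  fun O hO hne => hf O (hO.trans h) hne

theorem NowhereLocallyZero.mul {V : Opens M} {f g : M → ℂ} (hf : NowhereLocallyZero V f)
    (hfc : IsHolFun (n := n) V f) (hg : NowhereLocallyZero V g) :
    NowhereLocallyZero V (fun x => f x * g x) := by
  intro O hO hne
  obtain ⟨x, hx, hfx⟩ := hf O hO hne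
  have hc : ContinuousOn f O := (ContMDiffOn.continuousOn hfc).mono hO
  have ho : IsOpen ((O : Set M) ∩ f ⁻¹' {0}ᶜ) :=
    hc.isOpen_inter_preimage O.isOpen isOpen_compl_singleton
  obtain ⟨y, hy, hgy⟩ := hg ⟨_, ho⟩ (fun z hz => hO hz.1) ⟨x, hx, hfx⟩
  exact ⟨y, hy.1, mul_ne_zero hy.2 hgy⟩

variable [VectorBundle ℂ F E]

theorem IsHolSection.zero [ContMDiffVectorBundle ω F E (modelC n)] (V : Opens M) :
    IsHolSection (n := n) F E V 0 :=
  (Bundle.contMDiff_zeroSection ℂ E).contMDiffOn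

theorem IsHolSection.add {V : Opens M} {s t : Π x, E x} (hs : IsHolSection (n := n) F E V s)
    (ht : IsHolSection (n := n) F E V t) : IsHolSection (n := n) F E V (s + t) :=
  ContMDiffOn.add_section hs ht

theorem IsHolSection.smul {V : Opens M} {f : M → ℂ} {s : Π x, E x} (hf : IsHolFun (n := n) V f)
    (hs : IsHolSection (n := n) F E V s) : IsHolSection (n := n) F E V (fun x => f x • s x) :=
  ContMDiffOn.smul_section hf hs

namespace ModuleSubsheaf

/-- The saturation `G^sat` of `G` in the sheaf `ℰ` of sections of `E`, i.e. the kernel of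
`ℰ → (ℰ / G) / Torsion`: the sections some nonzero multiple of which lies locally in `G`. -/
def saturation [ContMDiffVectorBundle ω F E (modelC n)] (G : ModuleSubsheaf (n := n) F E) :
    ModuleSubsheaf (n := n) F E where
  sec V := {s | IsHolSection (n := n) F E V s ∧ ∀ x ∈ V, ∃ V' ≤ V, x ∈ V' ∧ ∃ f : M → ℂ,
    IsHolFun (n := n) V' f ∧ NowhereLocallyZero V' f ∧ (fun x => f x • s x) ∈ G.sec V'}
  isHol hs := hs.1
  zero_mem V := ⟨IsHolSection.zero V, fun x hx => ⟨V, le_rfl, hx, fun _ => 1, contMDiffOn_const,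
    fun O _ ⟨y, hy⟩ => ⟨y, hy, one_ne_zero⟩, by
      convert G.zero_mem V using 1
      funext y
      exact smul_zero _⟩⟩
  add_mem := by
    rintro V s t ⟨hs, hs'⟩ ⟨ht, ht'⟩
    refine ⟨hs.add ht, fun x hx => ?_⟩
    obtain ⟨A, hA, hxA, f, hf, hf0, hfs⟩ := hs' x hx
    obtain ⟨B, hB, hxB, g, hg, hg0, hgt⟩ := ht' x hx
    have hA' : A ⊓ B ≤ A := inf_le_left
    have hB' : A ⊓ B ≤ B := inf_le_right
    refine ⟨A ⊓ B, hA'.trans hA, ⟨hxA, hxB⟩, fun x => f x * g x, (hf.mono hA').mul (hg.mono hB'),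
      (hf0.mono hA').mul (hf.mono hA') (hg0.mono hB'), ?_⟩
    have h1 := G.smul_mem (hg.mono hB') (G.restrict hA' hfs)
    have h2 := G.smul_mem (hf.mono hA') (G.restrict hB' hgt)
    have h3 := G.add_mem h1 h2
    convert h3 using 1
    funext y
    simp [smul_smul, mul_comm]
  smul_mem := by
    rintro V f s hf ⟨hs, hs'⟩
    refine ⟨hs.smul hf, fun x hx => ?_⟩
    obtain ⟨A, hA, hxA, g, hg, hg0, hgs⟩ := hs' x hx
    refine ⟨A, hA, hxA, g, hg, hg0, ?_⟩
    convert G.smul_mem (hf.mono hA) hgs using 1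
    funext y
    simp [smul_smul, mul_comm]
  restrict := by
    rintro V V' s h ⟨hs, hs'⟩
    refine ⟨hs.mono h, fun x hx => ?_⟩
    obtain ⟨A, hA, hxA, g, hg, hg0, hgs⟩ := hs' x (h hx)
    exact ⟨A ⊓ V', inf_le_right, ⟨hxA, hx⟩, g, hg.mono inf_le_left, hg0.mono inf_le_left,
      G.restrict inf_le_left hgs⟩
  mem_of_locally := by
    intro V s h
    refine ⟨IsHolSection.of_locally fun x hx => ?_, fun x hx => ?_⟩
    · obtain ⟨V', h1, h2, t, ht, h3⟩ := h x hx
      exact ⟨V', h1, h2, t, ht.1, h3⟩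
    · obtain ⟨V', h1, h2, t, ht, h3⟩ := h x hx
      obtain ⟨A, hA, hxA, g, hg, hg0, hgs⟩ := ht.2 x h2
      refine ⟨A, hA.trans h1, hxA, g, hg, hg0, G.mem_of_locally fun y hy => ?_⟩
      exact ⟨A, le_rfl, hy, _, hgs, fun z hz => by simp only [h3 z (hA hz)]⟩

end ModuleSubsheaf

end Sheaves

section Tangent

variable {n : ℕ} (M : Type*) [TopologicalSpace M] [ChartedSpace (EuclideanSpace ℂ (Fin n)) M]
  [IsManifold (modelC n) ω M]

/-- The holomorphic tangent space of `M` at `x`. -/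
abbrev TanC (n : ℕ) (M : Type*) [TopologicalSpace M]
    [ChartedSpace (EuclideanSpace ℂ (Fin n)) M] (x : M) : Type :=
  TangentSpace (modelC n) x

/-- The holomorphic cotangent space of `M` at `x`. -/
abbrev CotC (n : ℕ) (M : Type*) [TopologicalSpace M]
    [ChartedSpace (EuclideanSpace ℂ (Fin n)) M] (x : M) : Type :=
  TangentSpace (modelC n) x →L[ℂ] Bundle.Trivial M ℂ x

/-- Subsheaves of `𝒪_M`-modules of the tangent sheaf `T_M` (holomorphic vector fields). -/
abbrev TangentSubsheaf (n : ℕ) (M : Type*) [TopologicalSpace M]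
    [ChartedSpace (EuclideanSpace ℂ (Fin n)) M] [IsManifold (modelC n) ω M] :=
  ModuleSubsheaf (n := n) (EuclideanSpace ℂ (Fin n)) (TanC n M)

/-- Subsheaves of `𝒪_M`-modules of the cotangent sheaf `Ω_M` (holomorphic `1`-forms). -/
abbrev CotangentSubsheaf (n : ℕ) (M : Type*) [TopologicalSpace M]
    [ChartedSpace (EuclideanSpace ℂ (Fin n)) M] [IsManifold (modelC n) ω M] :=
  ModuleSubsheaf (n := n) (EuclideanSpace ℂ (Fin n) →L[ℂ] ℂ) (CotC n M)

variable {M}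

/-- A distribution on `M`: a saturated coherent subsheaf of the tangent sheaf `T_M`. -/
def IsDistribution (W : TangentSubsheaf n M) : Prop :=
  W.IsFiniteType ∧ W.IsSaturated

/-- The kernel `Q` of `Ω_M → W^*` for a subsheaf `W ⊆ T_M`: the `1`-forms vanishing on the
sections of `W`. -/
def formsVanishingOn (W : TangentSubsheaf n M) : CotangentSubsheaf n M where
  sec V := {θ | IsHolSection (n := n) (EuclideanSpace ℂ (Fin n) →L[ℂ] ℂ) (CotC n M) V θ ∧
    ∀ V' ≤ V, ∀ X ∈ W.sec V', ∀ x ∈ V', θ x (X x) = 0}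
  isHol h := h.1
  zero_mem V := ⟨IsHolSection.zero V, fun _ _ _ _ _ _ => rfl⟩
  add_mem := by
    rintro V s t ⟨hs, hs'⟩ ⟨ht, ht'⟩
    refine ⟨hs.add ht, fun V' h X hX x hx => ?_⟩
    have h1 := hs' V' h X hX x hx
    have h2 := ht' V' h X hX x hx
    change s x (X x) + t x (X x) = 0
    rw [h1, h2]
    exact add_zero _
  smul_mem := by
    rintro V f s hf ⟨hs, hs'⟩
    refine ⟨hs.smul hf, fun V' h X hX x hx => ?_⟩
    have h1 := hs' V' h X hX x hx
    change f x • s x (X x) = 0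
    rw [h1]
    exact smul_zero _
  restrict := by
    rintro V V' s h ⟨hs, hs'⟩
    exact ⟨hs.mono h, fun A hA => hs' A (hA.trans h)⟩
  mem_of_locally := by
    intro V s h
    refine ⟨IsHolSection.of_locally fun x hx => ?_, fun A hA X hX x hx => ?_⟩
    · obtain ⟨V', h1, h2, t, ht, h3⟩ := h x hx
      exact ⟨V', h1, h2, t, ht.1, h3⟩
    · obtain ⟨V', h1, h2, t, ht, h3⟩ := h x (hA hx)
      rw [h3 x h2]
      exact ht.2 (A ⊓ V') inf_le_right X (W.restrict inf_le_left hX) x ⟨hx, h2⟩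

/-- The image of `S^* = (Ω_M / Q)^*` in `Ω_M^* = T_M` for a subsheaf `Q ⊆ Ω_M`: the vector fields
killed by the sections of `Q`. -/
def fieldsKilledBy (Q : CotangentSubsheaf n M) : TangentSubsheaf n M where
  sec V := {X | IsHolSection (n := n) (EuclideanSpace ℂ (Fin n)) (TanC n M) V X ∧
    ∀ V' ≤ V, ∀ θ ∈ Q.sec V', ∀ x ∈ V', θ x (X x) = 0}
  isHol h := h.1
  zero_mem V := ⟨IsHolSection.zero V, fun _ _ θ _ x _ => map_zero (θ x)⟩
  add_mem := by
    rintro V s t ⟨hs, hs'⟩ ⟨ht, ht'⟩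
    refine ⟨hs.add ht, fun V' h θ hθ x hx => ?_⟩
    have h1 := hs' V' h θ hθ x hx
    have h2 := ht' V' h θ hθ x hx
    refine (map_add (θ x) (s x) (t x)).trans ?_
    rw [h1, h2]
    exact add_zero _
  smul_mem := by
    rintro V f s hf ⟨hs, hs'⟩
    refine ⟨hs.smul hf, fun V' h θ hθ x hx => ?_⟩
    have h1 := hs' V' h θ hθ x hx
    refine (map_smul (θ x) (f x) (s x)).trans ?_
    rw [h1]
    exact smul_zero _
  restrict := by
    rintro V V' s h ⟨hs, hs'⟩
    exact ⟨hs.mono h, fun A hA => hs' A (hA.trans h)⟩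
  mem_of_locally := by
    intro V s h
    refine ⟨IsHolSection.of_locally fun x hx => ?_, fun A hA θ hθ x hx => ?_⟩
    · obtain ⟨V', h1, h2, t, ht, h3⟩ := h x hx
      exact ⟨V', h1, h2, t, ht.1, h3⟩
    · obtain ⟨V', h1, h2, t, ht, h3⟩ := h x (hA hx)
      rw [h3 x h2]
      exact ht.2 (A ⊓ V') inf_le_right θ (Q.restrict inf_le_left hθ) x ⟨hx, h2⟩

end Tangent

section Lifting

variable {m n : ℕ} {M : Type*} [TopologicalSpace M] [ChartedSpace (EuclideanSpace ℂ (Fin m)) M]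
  [IsManifold (modelC m) ω M]
  {N : Type*} [TopologicalSpace N] [ChartedSpace (EuclideanSpace ℂ (Fin n)) N]
  [IsManifold (modelC n) ω N]

/-- A finite surjective map of complex manifolds: holomorphic, proper, with finite fibres, and
surjective. -/
structure IsFiniteSurjective (m n : ℕ) {M : Type*} [TopologicalSpace M]
    [ChartedSpace (EuclideanSpace ℂ (Fin m)) M] {N : Type*} [TopologicalSpace N]
    [ChartedSpace (EuclideanSpace ℂ (Fin n)) N] (η : M → N) : Prop where
  isHol : ContMDiff (modelC m) (modelC n) ω η
  isProper : IsProperMap η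
  finite_fibres : ∀ y, (η ⁻¹' {y}).Finite
  surjective : Function.Surjective η

/-- The pull-back `η^*θ` of a `1`-form: `(η^*θ)_x = θ_{η(x)} ∘ dη_x`. -/
noncomputable def pullbackForm (η : M → N) (θ : Π y, CotC n N y) : Π x, CotC m M x :=
  fun x => (θ (η x)).comp (mfderiv (modelC m) (modelC n) η x)

/-- The image of `η^*Q → η^*Ω_N → Ω_M` for a subsheaf `Q ⊆ Ω_N`: the `1`-forms which are locally
`𝒪_M`-linear combinations of pull-backs of sections of `Q`. -/
noncomputable def pullbackForms (η : M → N) (Q : CotangentSubsheaf n N) : CotangentSubsheaf m M where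
  sec V := {ω' | IsHolSection (n := m) (EuclideanSpace ℂ (Fin m) →L[ℂ] ℂ) (CotC m M) V ω' ∧
    ∀ x ∈ V, ∃ V' ≤ V, x ∈ V' ∧ ∃ O : Opens N, Set.MapsTo η V' O ∧
      ∃ (k : ℕ) (f : Fin k → M → ℂ) (θ : Fin k → Π y, CotC n N y),
        (∀ i, IsHolFun (n := m) V' (f i)) ∧ (∀ i, θ i ∈ Q.sec O) ∧
        ∀ z ∈ V', ω' z = ∑ i, f i z • pullbackForm η (θ i) z}
  isHol h := h.1
  zero_mem V := ⟨IsHolSection.zero V, fun x hx => ⟨V, le_rfl, hx, ⊤, fun _ _ => trivial, 0,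
    fun i => i.elim0, fun i => i.elim0, fun i => i.elim0, fun i => i.elim0,
    fun z _ => by simp⟩⟩
  add_mem := by
    rintro V s t ⟨hs, hs'⟩ ⟨ht, ht'⟩
    refine ⟨hs.add ht, fun x hx => ?_⟩
    obtain ⟨A, hA, hxA, O, hO, k, f, θ, hf, hθ, h1⟩ := hs' x hx
    obtain ⟨B, hB, hxB, P, hP, l, g, ξ, hg, hξ, h2⟩ := ht' x hx
    refine ⟨A ⊓ B, inf_le_left.trans hA, ⟨hxA, hxB⟩, O ⊓ P, fun z hz => ⟨hO hz.1, hP hz.2⟩, k + l,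
      Fin.append f g, fun i => Fin.addCases (motive := fun _ => Π y, CotC n N y) θ ξ i,
      fun i => ?_, fun i => ?_, fun z hz => ?_⟩
    · refine Fin.addCases (fun j => ?_) (fun j => ?_) i
      · simpa using (hf j).mono inf_le_left
      · simpa using (hg j).mono inf_le_right
    · refine Fin.addCases (fun j => ?_) (fun j => ?_) i
      · simpa using Q.restrict inf_le_left (hθ j)
      · simpa using Q.restrict inf_le_right (hξ j)
    · rw [Fin.sum_univ_add]
      simp only [Fin.append_left, Fin.append_right, Fin.addCases_left, Fin.addCases_right]
      rw [← h1 z hz.1, ← h2 z hz.2]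
      rfl
  smul_mem := by
    rintro V g s hg ⟨hs, hs'⟩
    refine ⟨hs.smul hg, fun x hx => ?_⟩
    obtain ⟨A, hA, hxA, O, hO, k, f, θ, hf, hθ, h1⟩ := hs' x hx
    refine ⟨A, hA, hxA, O, hO, k, fun i x => g x * f i x, θ, fun i => (hg.mono hA).mul (hf i), hθ,
      fun z hz => ?_⟩
    simp only [h1 z hz, Finset.smul_sum, smul_smul]
  restrict := by
    rintro V V' s h ⟨hs, hs'⟩
    refine ⟨hs.mono h, fun x hx => ?_⟩
    obtain ⟨A, hA, hxA, O, hO, k, f, θ, hf, hθ, h1⟩ := hs' x (h hx)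
    exact ⟨A ⊓ V', inf_le_right, ⟨hxA, hx⟩, O, fun z hz => hO hz.1, k, f, θ,
      fun i => (hf i).mono inf_le_left, hθ, fun z hz => h1 z hz.1⟩
  mem_of_locally := by
    intro V s h
    refine ⟨IsHolSection.of_locally fun x hx => ?_, fun x hx => ?_⟩
    · obtain ⟨V', h1, h2, t, ht, h3⟩ := h x hx
      exact ⟨V', h1, h2, t, ht.1, h3⟩
    · obtain ⟨V', h1, h2, t, ht, h3⟩ := h x hx
      obtain ⟨A, hA, hxA, O, hO, k, f, θ, hf, hθ, h4⟩ := ht.2 x h2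
      exact ⟨A, hA.trans h1, hxA, O, hO, k, f, θ, hf, hθ, fun z hz => by
        rw [h3 z (hA hz), h4 z hz]⟩

/-- The lifting `η^{-1} W ⊆ T_M` of a distribution `W ⊆ T_N`: let `Q` be the kernel of
`Ω_N → W^*`, let `Q^sat` be the saturation in `Ω_M` of the image of `η^*Q`, and let `S` be
`Ω_M / Q^sat`; then `η^{-1} W = S^* ⊆ T_M`. -/
noncomputable def lifting (η : M → N) (W : TangentSubsheaf n N) : TangentSubsheaf m M :=
  fieldsKilledBy (pullbackForms (m := m) η (formsVanishingOn W)).saturation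

end Lifting

/-!
Upstairs, the projection `p : T_{U'} → η⁻¹W₁` along `η⁻¹W₂` is a holomorphic endomorphism of the
tangent bundle. The dimensions agree: fewer than `dim U'` holomorphic functions have an infinite
common fibre, and Sard's theorem provides a point where the differential of `η` is surjective. A
common section of `W₁` and `W₂` lifts at the points where `η` is étale, hence vanishes there, hence
everywhere.

For the decomposition of a section `s` of `T_U`, finitely many sections near a point, taken from
`W₁` and from `W₂`, have a determinant `δ` which is not locally zero, and Cramer's rule writes
`δ s = A₁ + A₂` with `Aᵢ` a section of `Wᵢ`. At the étale points `A₁ / δ = J p J⁻¹ s` with `J` the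
differential of `η`, so that `det J · (A₁ / δ) ∘ η = J p adj(J) s` is locally bounded. By properness
of `η` and the change of variables `∫_{η(B)} |q|² ≤ ∫_B |det J|² |q ∘ η|²`, the quotient `A₁ / δ` is
locally square integrable, and a square integrable quotient of holomorphic functions is
holomorphic: in one variable square integrability excludes poles, and in several variables the
averages over circles in a line depend holomorphically on the line. As `W₁` and `W₂` are saturated,
`Aᵢ / δ` is a section of `Wᵢ`, and the local decompositions glue because they are unique.
-/

local notation "ℂ^" n:max => EuclideanSpace ℂ (Fin n)

section Superposition

open Filter Topology Metric

variable {𝕜 X E F : Type*} [NontriviallyNormedField 𝕜] [TopologicalSpace X] [CompactSpace X]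
  [NormedAddCommGroup E] [NormedSpace 𝕜 E] [NormedAddCommGroup F] [NormedSpace 𝕜 F]

/-- The continuous multilinear map `u ↦ (t ↦ q (u t))` on continuous functions on the compact
space `X`: the terms of the power series of a superposition operator. -/
noncomputable def superposeMultilinear (X : Type*) [TopologicalSpace X] [CompactSpace X]
    {ι : Type*} [Fintype ι] (q : ContinuousMultilinearMap 𝕜 (fun _ : ι => E) F) :
    ContinuousMultilinearMap 𝕜 (fun _ : ι => C(X, E)) C(X, F) :=
  MultilinearMap.mkContinuous
    { toFun := fun u => ⟨fun t => q fun i => u i t, by fun_prop⟩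
      map_update_add' := by
        intro _ u i v w
        ext t
        simp [Function.apply_update (fun _ (f : C(X, E)) => f t)]
      map_update_smul' := by
        intro _ u i c v
        ext t
        simp [Function.apply_update (fun _ (f : C(X, E)) => f t)] }
    ‖q‖ fun u => by
      rw [ContinuousMap.norm_le _ (by positivity)]
      intro t
      refine (q.le_opNorm _).trans ?_
      gcongr with i
      exact (u i).norm_coe_le_norm t

theorem norm_superposeMultilinear_le {ι : Type*} [Fintype ι]
    (q : ContinuousMultilinearMap 𝕜 (fun _ : ι => E) F) : ‖superposeMultilinear X q‖ ≤ ‖q‖ :=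
  MultilinearMap.mkContinuous_norm_le _ (norm_nonneg _) _

/-- The power series of the superposition operator `u ↦ f ∘ u` on `C(X, E)`, where `p` is the power
series of `f`. -/
noncomputable def superposeSeries (X : Type*) [TopologicalSpace X] [CompactSpace X]
    (p : FormalMultilinearSeries 𝕜 E F) : FormalMultilinearSeries 𝕜 C(X, E) C(X, F) :=
  fun k => superposeMultilinear X (p k)

theorem radius_le_radius_superposeSeries (p : FormalMultilinearSeries 𝕜 E F) :
    p.radius ≤ (superposeSeries X p).radius := by
  refine ENNReal.le_of_forall_nnreal_lt fun r hr => ?_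
  obtain ⟨C, -, hC⟩ := p.norm_mul_pow_le_of_lt_radius hr
  refine (superposeSeries X p).le_radius_of_bound C fun k => le_trans ?_ (hC k)
  gcongr
  exact norm_superposeMultilinear_le (p k)

theorem superposeSeries_sum_apply [CompleteSpace F] (p : FormalMultilinearSeries 𝕜 E F)
    {u : C(X, E)} (hu : u ∈ eball (0 : C(X, E)) p.radius) (t : X) :
    (superposeSeries X p).sum u t = p.sum (u t) := by
  have hs : Summable fun k => superposeSeries X p k fun _ => u :=
    ((superposeSeries X p).summable_norm_apply
      (eball_subset_eball (radius_le_radius_superposeSeries p) hu)).of_norm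
  exact (ContinuousMap.evalCLM 𝕜 t).map_tsum hs

theorem exists_analyticAt_comp_add [CompleteSpace F] {f : E → F}
    {p : FormalMultilinearSeries 𝕜 E F} {R : ENNReal} (hf : HasFPowerSeriesOnBall f p 0 R)
    {γ : C(X, E)} (hγ : γ ∈ eball (0 : C(X, E)) R) :
    ∃ g : E → C(X, F), AnalyticAt 𝕜 g 0 ∧ ∀ᶠ x in 𝓝 0, ∀ t, g x t = f (x + γ t) := by
  let K : E → C(X, E) := fun x => ContinuousMap.const X x + γ
  have hK0 : K 0 = γ := by ext t; simp [K]
  have hK : AnalyticAt 𝕜 K 0 :=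
    ((ContinuousLinearMap.const 𝕜 X : E →L[𝕜] C(X, E)).analyticAt 0).add analyticAt_const
  have hradius := radius_le_radius_superposeSeries (X := X) p
  have hsum : AnalyticAt 𝕜 (superposeSeries X p).sum (K 0) := by
    refine ((superposeSeries X p).hasFPowerSeriesOnBall
      ((hf.r_pos.trans_le hf.r_le).trans_le hradius)).analyticAt_of_mem ?_
    rw [hK0]
    exact eball_subset_eball (hf.r_le.trans hradius) hγ
  refine ⟨fun x => (superposeSeries X p).sum (K x), hsum.fun_comp hK, ?_⟩
  have hKball : ∀ᶠ x in 𝓝 0, K x ∈ eball (0 : C(X, E)) R :=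
    hK.continuousAt.eventually_mem (isOpen_eball.mem_nhds (by rwa [hK0]))
  filter_upwards [hKball] with x hx t
  have ht : K x t ∈ eball (0 : E) R := by
    rw [mem_eball_zero_iff] at hx ⊢
    exact (enorm_le_iff_norm_le.2 ((K x).norm_coe_le_norm t)).trans_lt hx
  rw [superposeSeries_sum_apply p (eball_subset_eball hf.r_le hx), ← hf.sum ht, zero_add]
  rfl

theorem exists_analyticAt_div_comp_add [CompleteSpace 𝕜] {a d : E → 𝕜}
    {p q : FormalMultilinearSeries 𝕜 E 𝕜} {R : ENNReal} (ha : HasFPowerSeriesOnBall a p 0 R)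
    (hd : HasFPowerSeriesOnBall d q 0 R) {γ : C(X, E)} (hγ : γ ∈ eball (0 : C(X, E)) R)
    (hγd : ∀ t, d (γ t) ≠ 0) :
    ∃ g : E → C(X, 𝕜), AnalyticAt 𝕜 g 0 ∧
      ∀ᶠ x in 𝓝 0, ∀ t, g x t = a (x + γ t) / d (x + γ t) := by
  obtain ⟨ga, hga, hgaa⟩ := exists_analyticAt_comp_add ha hγ
  obtain ⟨gd, hgd, hgdd⟩ := exists_analyticAt_comp_add hd hγ
  obtain ⟨u, hu⟩ : IsUnit (gd 0) := by
    rw [ContinuousMap.isUnit_iff_forall_ne_zero]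
    intro t
    simpa [hgdd.self_of_nhds t] using hγd t
  refine ⟨_, hga.mul ((analyticAt_inverse (𝕜 := 𝕜) u).fun_comp_of_eq hgd hu.symm), ?_⟩
  have hunit : ∀ᶠ x in 𝓝 0, IsUnit (gd x) :=
    hgd.continuousAt.eventually_mem (Units.isOpen.mem_nhds ⟨u, hu⟩)
  filter_upwards [hgaa, hgdd, hunit] with x hax hdx hux t
  have hinv := congrArg (fun f : C(X, 𝕜) => f t) (Ring.mul_inverse_cancel _ hux)
  simp only [ContinuousMap.mul_apply, ContinuousMap.one_apply, hdx t] at hinv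
  rw [Pi.mul_apply, ContinuousMap.mul_apply, hax t, eq_div_iff (left_ne_zero_of_mul_eq_one hinv),
    mul_assoc, mul_comm _ (d _), hinv, mul_one]

end Superposition

section OneVariable

open Asymptotics Filter Topology MeasureTheory Metric

theorem lintegral_enorm_sub_inv_sq_eq_top {z₀ : ℂ} {s : Set ℂ} (hs : s ∈ 𝓝 z₀) :
    ∫⁻ z in s, ‖(z - z₀)⁻¹‖ₑ ^ 2 = ⊤ := by
  obtain ⟨r, hr, hrs⟩ := Metric.mem_nhds_iff.1 hs
  have htranslate : ∫⁻ z in ball (0 : ℂ) r, ‖z⁻¹‖ₑ ^ 2 = ∫⁻ z in ball z₀ r, ‖(z - z₀)⁻¹‖ₑ ^ 2 := by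
    have hpre : (fun z => z - z₀) ⁻¹' ball (0 : ℂ) r = ball z₀ r := by
      ext z
      simp [dist_eq_norm]
    rw [← hpre]
    exact ((measurePreserving_sub_right volume z₀).setLIntegral_comp_preimage measurableSet_ball
      (by fun_prop)).symm
  by_contra hfin
  have hball : ∫⁻ z in ball (0 : ℂ) r, ‖z⁻¹‖ₑ ^ 2 ≠ ⊤ := by
    rw [htranslate]
    exact ne_top_of_le_ne_top hfin (lintegral_mono_set hrs)
  have hintegrable : IntegrableOn (fun z : ℂ => (‖z‖⁻¹) ^ 2) (ball 0 r) := by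
    refine ⟨by fun_prop, lt_of_le_of_lt (lintegral_mono fun z => ?_) hball.lt_top⟩
    simp [enorm_pow, ← norm_inv]
  rw [integrableOn_fun_norm_addHaar (μ := volume) (f := fun y : ℝ => (y⁻¹) ^ 2),
    Complex.finrank_real_complex] at hintegrable
  have hinv : IntervalIntegrable (fun y : ℝ => y⁻¹) volume 0 r := by
    rw [intervalIntegrable_iff_integrableOn_Ioo_of_le hr.le]
    refine hintegrable.congr_fun (fun y hy => ?_) measurableSet_Ioo
    have : y ≠ 0 := hy.1.ne'
    simp only [Nat.add_one_sub_one, pow_one, inv_pow, smul_eq_mul]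
    field_simp
  simp [intervalIntegrable_inv_iff, hr.ne] at hinv

theorem isBigO_inv_sub_of_meromorphicOrderAt_neg {𝕜 E : Type*} [NontriviallyNormedField 𝕜]
    [NormedAddCommGroup E] [NormedSpace 𝕜 E] {f : 𝕜 → E} {z₀ : 𝕜}
    (hf : meromorphicOrderAt f z₀ < 0) : (fun z => (z - z₀)⁻¹) =O[𝓝[≠] z₀] f := by
  have hmero : MeromorphicAt f z₀ := meromorphicAt_of_meromorphicOrderAt_ne_zero hf.ne
  obtain ⟨n, hn⟩ := WithTop.ne_top_iff_exists.1 (hf.trans_le le_top).ne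
  obtain ⟨g, hg, hg0, hfg⟩ := (meromorphicOrderAt_eq_int_iff hmero).1 hn.symm
  obtain ⟨k, rfl⟩ : ∃ k : ℕ, n = -(k + 1) :=
    ⟨(-n - 1).toNat, by have : n < 0 := (by exact_mod_cast hn ▸ hf); omega⟩
  have hone : (fun _ => (1 : 𝕜)) =O[𝓝[≠] z₀] g :=
    (isBigO_const_left_iff_pos_le_norm one_ne_zero).2 ⟨‖g z₀‖ / 2, by positivity,
      (hg.continuousAt.norm.eventually_const_le (half_lt_self (by positivity))).filter_mono
        nhdsWithin_le_nhds⟩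
  have hpow : (fun z => (z - z₀) ^ k) =O[𝓝[≠] z₀] fun _ => (1 : 𝕜) :=
    ((by fun_prop : ContinuousAt (fun z => (z - z₀) ^ k) z₀).mono_left
      nhdsWithin_le_nhds).isBigO_one 𝕜
  have hzpow := ((isBigO_refl (fun z => (z - z₀) ^ (-(k + 1 : ℤ))) (𝓝[≠] z₀)).mul
    hpow).smul hone
  refine (hzpow.congr' ?_ ?_)
  · filter_upwards [self_mem_nhdsWithin] with z hz
    have : z - z₀ ≠ 0 := sub_ne_zero.2 hz
    rw [smul_eq_mul, mul_one, zpow_neg, zpow_add_one₀ this, zpow_natCast]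
    field_simp
  · filter_upwards [hfg] with z hz
    rw [hz, mul_one]

/-- A pole of order `k ≥ 1` dominates `(z - z₀)⁻¹`, which is not `L²`. -/
theorem meromorphicOrderAt_nonneg_of_lintegral_enorm_sq {f : ℂ → ℂ} {z₀ : ℂ} {s : Set ℂ}
    (hs : s ∈ 𝓝 z₀) (hL : ∫⁻ z in s, ‖f z‖ₑ ^ 2 ≠ ⊤) : 0 ≤ meromorphicOrderAt f z₀ := by
  by_contra! horder
  obtain ⟨C, hC⟩ := (isBigO_inv_sub_of_meromorphicOrderAt_neg horder).bound
  have hbound : ∀ᶠ z in 𝓝 z₀, ‖(z - z₀)⁻¹‖ₑ ≤ ENNReal.ofReal C * ‖f z‖ₑ := by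
    filter_upwards [eventually_nhdsWithin_iff.1 hC] with z hz
    by_cases hzz : z = z₀
    · simp [hzz]
    · rw [← ofReal_norm, ← ofReal_norm, ← ENNReal.ofReal_mul' (norm_nonneg _)]
      exact ENNReal.ofReal_le_ofReal (hz hzz)
  obtain ⟨t, ht, htopen, hzt⟩ := _root_.mem_nhds_iff.1 (inter_mem hbound hs)
  have hle : ∫⁻ z in t, ‖(z - z₀)⁻¹‖ₑ ^ 2 ≤ ENNReal.ofReal C ^ 2 * ∫⁻ z in s, ‖f z‖ₑ ^ 2 :=
    calc ∫⁻ z in t, ‖(z - z₀)⁻¹‖ₑ ^ 2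
        ≤ ∫⁻ z in t, ENNReal.ofReal C ^ 2 * ‖f z‖ₑ ^ 2 := by
          refine setLIntegral_mono' htopen.measurableSet fun z hz => ?_
          rw [← mul_pow]
          gcongr
          exact (ht hz).1
      _ = ENNReal.ofReal C ^ 2 * ∫⁻ z in t, ‖f z‖ₑ ^ 2 := lintegral_const_mul' _ _ (by simp)
      _ ≤ ENNReal.ofReal C ^ 2 * ∫⁻ z in s, ‖f z‖ₑ ^ 2 := by
          gcongr
          exact fun z hz => (ht hz).2
  rw [lintegral_enorm_sub_inv_sq_eq_top (htopen.mem_nhds hzt), top_le_iff] at hle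
  exact ENNReal.mul_ne_top (by simp) hL hle

/-- The quotient is holomorphic, since its poles would contradict square integrability. -/
theorem mul_circleAverage_div_eq {a d : ℂ → ℂ} {c : ℂ} {R : ℝ} (hR : 0 < R)
    (ha : AnalyticOnNhd ℂ a (closedBall c R)) (hd : AnalyticOnNhd ℂ d (closedBall c R))
    (hd0 : ∀ z ∈ sphere c R, d z ≠ 0) (hL : ∫⁻ z in ball c R, ‖a z / d z‖ₑ ^ 2 ≠ ⊤) :
    d c * Real.circleAverage (fun z => a z / d z) c R = a c := by
  have hc : c ∈ closedBall c R := mem_closedBall_self hR.le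
  have hf : MeromorphicOn (fun z => a z / d z) (closedBall c R) :=
    fun z hz => (ha z hz).meromorphicAt.div (hd z hz).meromorphicAt
  set q := toMeromorphicNFOn (fun z => a z / d z) (closedBall c R) with hq
  have hqan : AnalyticOnNhd ℂ q (closedBall c R) := fun z hz => by
    rw [← ((meromorphicNFOn_toMeromorphicNFOn _ _) hz).meromorphicOrderAt_nonneg_iff_analyticAt,
      meromorphicOrderAt_toMeromorphicNFOn hf hz]
    by_cases hzR : z ∈ ball c R
    · exact meromorphicOrderAt_nonneg_of_lintegral_enorm_sq (isOpen_ball.mem_nhds hzR) hL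
    · refine ((ha z hz).div (hd z hz) (hd0 z ?_)).meromorphicOrderAt_nonneg
      exact (mem_closedBall.1 hz).antisymm (not_lt.1 hzR)
  have hqsphere : Set.EqOn (fun z => a z / d z) q (sphere c |R|) := fun z hz => by
    rw [abs_of_pos hR] at hz
    have hz' := sphere_subset_closedBall hz
    rw [hq, toMeromorphicNFOn_eq_toMeromorphicNFAt hf hz', toMeromorphicNFAt_eq_self.2]
    exact ((ha z hz').div (hd z hz') (hd0 z hz)).meromorphicNFAt
  have hdc : ∀ᶠ z in 𝓝[≠] c, d z ≠ 0 := by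
    refine (hd c hc).eventually_eq_zero_or_eventually_ne_zero.resolve_left fun h => ?_
    have hmem : c + R ∈ sphere c R := by simp [abs_of_pos hR]
    exact hd0 _ hmem (hd.eqOn_zero_of_preconnected_of_eventuallyEq_zero
      (convex_closedBall c R).isPreconnected hc h (sphere_subset_closedBall hmem))
  have hmul : (fun z => d z * q z) =ᶠ[𝓝[≠] c] a := by
    filter_upwards [hdc, hf.toMeromorphicNFOn_eq_self_on_nhdsNE hc] with z hdz hqz
    rw [hq, hqz, mul_div_cancel₀ _ hdz]
  have hqmean : Real.circleAverage q c R = q c := by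
    refine DiffContOnCl.circleAverage (DifferentiableOn.diffContOnCl ?_)
    rw [abs_of_pos hR, closure_ball c hR.ne']
    exact hqan.differentiableOn
  rw [Real.circleAverage_congr_sphere hqsphere, hqmean]
  exact ((((hd c hc).mul (hqan c hc)).continuousAt.eventuallyEq_nhds_iff_eventuallyEq_nhdsNE
    (ha c hc).continuousAt).1 hmul).eq_of_nhds

end OneVariable

section Division

open Filter Topology MeasureTheory Metric

/-- Averaging over a circle, as a functional on the continuous functions on the circle. -/
noncomputable def circleAverageCLM {F : Type*} [NormedAddCommGroup F] [NormedSpace ℂ F] (c : ℂ)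
    {R : ℝ} (hR : 0 ≤ R) : C(sphere c R, F) →L[ℂ] F :=
  have hcont : Continuous fun θ : ℝ => (⟨circleMap c R θ, circleMap_mem_sphere c hR θ⟩ :
      sphere c R) :=
    (continuous_circleMap c R).subtype_mk _
  LinearMap.mkContinuous
    { toFun := fun g => (2 * Real.pi : ℝ)⁻¹ • ∫ θ in (0 : ℝ)..2 * Real.pi,
        g ⟨circleMap c R θ, circleMap_mem_sphere c hR θ⟩
      map_add' := fun f g => by
        simp only [ContinuousMap.add_apply]
        rw [intervalIntegral.integral_add, smul_add]
        · exact (f.continuous.comp hcont).intervalIntegrable _ _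
        · exact (g.continuous.comp hcont).intervalIntegrable _ _
      map_smul' := fun a f => by
        simp only [ContinuousMap.smul_apply, RingHom.id_apply]
        rw [intervalIntegral.integral_smul, smul_comm] }
    1 fun g => by
      have hpi : 0 < 2 * Real.pi := Real.two_pi_pos
      have hnorm :
          ‖∫ θ in (0 : ℝ)..2 * Real.pi, g ⟨circleMap c R θ, circleMap_mem_sphere c hR θ⟩‖ ≤
            ‖g‖ * |2 * Real.pi - 0| :=
        intervalIntegral.norm_integral_le_of_norm_le_const fun θ _ => g.norm_coe_le_norm _
      rw [sub_zero, abs_of_pos hpi] at hnorm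
      change ‖(2 * Real.pi : ℝ)⁻¹ • (_ : F)‖ ≤ _
      rwa [norm_smul, norm_inv, Real.norm_of_nonneg hpi.le, one_mul, inv_mul_le_iff₀ hpi,
        mul_comm _ ‖g‖]

theorem circleAverageCLM_eq {F : Type*} [NormedAddCommGroup F] [NormedSpace ℂ F] {c : ℂ} {R : ℝ}
    (hR : 0 ≤ R) (g : C(sphere c R, F)) {f : ℂ → F} (h : ∀ t : sphere c R, g t = f t) :
    circleAverageCLM c hR g = Real.circleAverage f c R := by
  change (2 * Real.pi : ℝ)⁻¹ • (_ : F) = _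
  rw [Real.circleAverage]
  congr 1
  exact intervalIntegral.integral_congr fun θ _ => h _

variable {E : Type*} [NormedAddCommGroup E] [NormedSpace ℂ E]

theorem analyticAt_circleAverage_div {a d : E → ℂ} {p q : FormalMultilinearSeries ℂ E ℂ}
    {x₀ e : E} {r : ENNReal} {ε : ℝ} (hp : HasFPowerSeriesOnBall a p x₀ r)
    (hq : HasFPowerSeriesOnBall d q x₀ r) (hε : 0 ≤ ε) (he : (ε : ℂ) • e ∈ eball 0 r)
    (hde : ∀ z ∈ sphere (0 : ℂ) ε, d (x₀ + z • e) ≠ 0) :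
    AnalyticAt ℂ (fun x => Real.circleAverage (fun z => a (x + z • e) / d (x + z • e)) 0 ε) x₀ := by
  have hp' : HasFPowerSeriesOnBall (fun x => a (x₀ + x)) p 0 r := by
    simpa [add_comm] using hp.comp_sub (-x₀)
  have hq' : HasFPowerSeriesOnBall (fun x => d (x₀ + x)) q 0 r := by
    simpa [add_comm] using hq.comp_sub (-x₀)
  let γ : C(sphere (0 : ℂ) ε, E) := ⟨fun z => (z : ℂ) • e, by fun_prop⟩
  have hγ : γ ∈ eball 0 r := by
    rw [mem_eball_zero_iff] at he ⊢
    refine lt_of_le_of_lt (enorm_le_iff_norm_le.2 ?_) he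
    refine (ContinuousMap.norm_le _ (norm_nonneg _)).2 fun t => ?_
    simp [γ, norm_smul, abs_of_nonneg hε]
  obtain ⟨g, hga, hg⟩ := exists_analyticAt_div_comp_add hp' hq' hγ fun t => hde t t.2
  have hmap : Tendsto (fun x : E => x - x₀) (𝓝 x₀) (𝓝 0) := by
    simpa using (continuous_sub_right x₀).tendsto x₀
  have hb : AnalyticAt ℂ (fun x => circleAverageCLM 0 hε (g (x - x₀))) x₀ :=
    ((circleAverageCLM 0 hε).analyticAt _).fun_comp_of_eq
      (hga.fun_comp_of_eq (analyticAt_id.sub analyticAt_const) (sub_self x₀)) rfl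
  refine hb.congr ?_
  filter_upwards [hmap.eventually hg] with x hx
  refine circleAverageCLM_eq hε _ fun t => ?_
  rw [hx t, ← add_assoc, add_sub_cancel]
  rfl

theorem exists_forall_sphere_ne_zero {d : E → ℂ} {x₀ : E} (hd : AnalyticAt ℂ d x₀)
    (hd0 : ¬ ∀ᶠ x in 𝓝 x₀, d x = 0) {r : ℝ} (hr : 0 < r) :
    ∃ e : E, ‖e‖ < r ∧ ∃ ε ∈ Set.Ioo (0 : ℝ) 1, ∀ z ∈ sphere (0 : ℂ) ε, d (x₀ + z • e) ≠ 0 := by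
  obtain ⟨ρ, hρ, hρd⟩ := Metric.eventually_nhds_iff_ball.1 hd.eventually_analyticAt
  obtain ⟨x, hdx, hx⟩ :=
    ((not_eventually.1 hd0).and_eventually (ball_mem_nhds x₀ (lt_min hr hρ))).exists
  obtain ⟨e, rfl⟩ : ∃ e, x = x₀ + e := ⟨x - x₀, (add_sub_cancel x₀ x).symm⟩
  rw [dist_eq_norm, add_sub_cancel_left] at hx
  refine ⟨e, hx.trans_le (min_le_left _ _), ?_⟩
  have hD : AnalyticOnNhd ℂ (fun z : ℂ => d (x₀ + z • e)) (closedBall 0 1) := by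
    intro z hz
    refine AnalyticAt.fun_comp_of_eq (hρd (x₀ + z • e) ?_)
      (analyticAt_const.add (analyticAt_id.smul analyticAt_const)) rfl
    rw [mem_ball_iff_norm, add_sub_cancel_left, norm_smul]
    exact (mul_le_of_le_one_left (norm_nonneg _) (mem_closedBall_zero_iff.1 hz)).trans_lt
      (hx.trans_le (min_le_right _ _))
  have hD0 : ¬ ∀ᶠ z : ℂ in 𝓝 0, d (x₀ + z • e) = 0 := fun h => hdx <| by
    simpa using hD.eqOn_zero_of_preconnected_of_eventuallyEq_zero
      (convex_closedBall 0 1).isPreconnected (mem_closedBall_self zero_le_one) h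
      (show (1 : ℂ) ∈ closedBall (0 : ℂ) 1 by simp)
  have hiso := (hD 0 (by simp)).eventually_eq_zero_or_eventually_ne_zero.resolve_left hD0
  obtain ⟨δ, hδ, hδd⟩ := Metric.mem_nhds_iff.1 (eventually_nhdsWithin_iff.1 hiso)
  obtain ⟨ε, hε0, hε1⟩ := exists_between (lt_min hδ one_pos)
  refine ⟨ε, ⟨hε0, hε1.trans_le (min_le_right _ _)⟩, fun z hz => hδd ?_ ?_⟩
  · simpa [mem_sphere_zero_iff_norm.1 hz] using hε1.trans_le (min_le_left _ _)
  · exact ne_of_mem_sphere hz hε0.ne'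

theorem eventually_forall_add_smul {P : E → Prop} {K : Set ℂ} (hK : IsCompact K) {x₀ e : E}
    (hP : ∀ z ∈ K, ∀ᶠ x in 𝓝 (x₀ + z • e), P x) : ∀ᶠ x in 𝓝 x₀, ∀ z ∈ K, P (x + z • e) := by
  refine hK.eventually_forall_of_forall_eventually fun z hz => ?_
  have : ContinuousAt (fun p : E × ℂ => p.1 + p.2 • e) (x₀, z) := by fun_prop
  exact this.eventually (hP z hz)

theorem ae_lintegral_comp_add_ne_top {G T : Type*} [AddGroup G] [MeasurableSpace G]
    [MeasurableAdd₂ G] {μ : Measure G} [SFinite μ] [μ.IsAddRightInvariant] [MeasurableSpace T]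
    (ν : Measure T) [IsFiniteMeasure ν] {h : G → ENNReal} (hm : Measurable h)
    (hfin : ∫⁻ x, h x ∂μ ≠ ⊤) {φ : T → G} (hφ : Measurable φ) :
    ∀ᵐ x ∂μ, ∫⁻ t, h (x + φ t) ∂ν ≠ ⊤ := by
  have hmeas : Measurable fun p : G × T => h (p.1 + φ p.2) :=
    hm.comp (measurable_fst.add (hφ.comp measurable_snd))
  have hiterated : ∫⁻ x, ∫⁻ t, h (x + φ t) ∂ν ∂μ ≠ ⊤ := by
    rw [lintegral_lintegral_swap hmeas.aemeasurable]
    simp only [lintegral_add_right_eq_self, lintegral_const]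
    exact ENNReal.mul_ne_top hfin (measure_ne_top ν _)
  filter_upwards [ae_lt_top hmeas.lintegral_prod_right' hiterated] with x hx using hx.ne

variable [FiniteDimensional ℂ E] [MeasurableSpace E] [BorelSpace E] (μ : Measure E)
  [μ.IsAddHaarMeasure]

theorem ae_eq_mul_circleAverage_div {a d : E → ℂ} {U : Set E} (hU : IsOpen U)
    (ha : AnalyticOnNhd ℂ a U) (hd : AnalyticOnNhd ℂ d U)
    (hL : ∫⁻ x in U, ‖a x / d x‖ₑ ^ 2 ∂μ ≠ ⊤) (e : E) {ε : ℝ} (hε : 0 < ε) :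
    ∀ᵐ x ∂μ, (∀ z ∈ closedBall (0 : ℂ) ε, x + z • e ∈ U) →
      (∀ z ∈ sphere (0 : ℂ) ε, d (x + z • e) ≠ 0) →
      a x = d x * Real.circleAverage (fun z => a (x + z • e) / d (x + z • e)) 0 ε := by
  have := FiniteDimensional.proper ℂ E
  have hmeas {f : E → ℂ} (hf : AnalyticOnNhd ℂ f U) : Measurable (U.indicator f) := by
    classical
    rw [← Set.piecewise_eq_indicator]
    exact hf.continuousOn.measurable_piecewise continuousOn_const hU.measurableSet
  have hfin : ∫⁻ x, ‖U.indicator a x / U.indicator d x‖ₑ ^ 2 ∂μ ≠ ⊤ := by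
    convert hL using 1
    rw [← lintegral_indicator hU.measurableSet]
    congr 1 with x
    by_cases hx : x ∈ U <;> simp [hx]
  have : Fact (volume (ball (0 : ℂ) ε) < ⊤) := ⟨measure_ball_lt_top⟩
  filter_upwards [ae_lintegral_comp_add_ne_top (volume.restrict (ball (0 : ℂ) ε))
    (((hmeas ha).div (hmeas hd)).enorm.pow_const 2) hfin
    (measurable_id.smul_const e)] with x hx hxU hxd
  have hline : ∀ z : ℂ, AnalyticAt ℂ (fun z : ℂ => x + z • e) z := fun z =>
    analyticAt_const.add (analyticAt_id.smul analyticAt_const)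
  have hLx : ∫⁻ z in ball (0 : ℂ) ε, ‖a (x + z • e) / d (x + z • e)‖ₑ ^ 2 ≠ ⊤ := by
    convert hx using 1
    refine setLIntegral_congr_fun measurableSet_ball fun z hz => ?_
    simp [hxU z (ball_subset_closedBall hz)]
  simpa using (mul_circleAverage_div_eq hε
    (fun z hz => (ha _ (hxU z hz)).fun_comp_of_eq (hline z) rfl)
    (fun z hz => (hd _ (hxU z hz)).fun_comp_of_eq (hline z) rfl) hxd hLx).symm

theorem eventually_eq_mul_circleAverage_div {a d : E → ℂ} {U : Set E} (hU : IsOpen U)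
    (ha : AnalyticOnNhd ℂ a U) (hd : AnalyticOnNhd ℂ d U)
    (hL : ∫⁻ x in U, ‖a x / d x‖ₑ ^ 2 ∂μ ≠ ⊤) {x₀ e : E} {ε : ℝ} (hε : 0 < ε)
    (hxU : ∀ z ∈ closedBall (0 : ℂ) ε, x₀ + z • e ∈ U)
    (hxd : ∀ z ∈ sphere (0 : ℂ) ε, d (x₀ + z • e) ≠ 0)
    (hb : ∀ᶠ x in 𝓝 x₀, ContinuousAt
      (fun x => Real.circleAverage (fun z => a (x + z • e) / d (x + z • e)) 0 ε) x) :
    ∀ᶠ x in 𝓝 x₀, a x = d x * Real.circleAverage (fun z => a (x + z • e) / d (x + z • e)) 0 ε := by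
  have hstay : ∀ᶠ x in 𝓝 x₀, ∀ z ∈ closedBall (0 : ℂ) ε, x + z • e ∈ U :=
    eventually_forall_add_smul (isCompact_closedBall 0 ε) fun z hz => hU.mem_nhds (hxU z hz)
  have hne : ∀ᶠ x in 𝓝 x₀, ∀ z ∈ sphere (0 : ℂ) ε, d (x + z • e) ≠ 0 :=
    eventually_forall_add_smul (isCompact_sphere 0 ε) fun z hz =>
      (hd _ (hxU z (sphere_subset_closedBall hz))).continuousAt.eventually_ne (hxd z hz)
  obtain ⟨T, hT, hTo, hx₀T⟩ := _root_.eventually_nhds_iff.1 ((hstay.and hne).and hb)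
  have hTU : T ⊆ U := fun x hx => by
    simpa using (hT x hx).1.1 0 (mem_closedBall_self hε.le)
  have heq : a =ᵐ[μ.restrict T] fun x =>
      d x * Real.circleAverage (fun z => a (x + z • e) / d (x + z • e)) 0 ε := by
    filter_upwards [ae_restrict_of_ae (ae_eq_mul_circleAverage_div μ hU ha hd hL e hε),
      ae_restrict_mem hTo.measurableSet] with x hx hxT
    exact hx (hT x hxT).1.1 (hT x hxT).1.2
  exact (Measure.eqOn_open_of_ae_eq heq hTo (ha.continuousOn.mono hTU) fun x hx =>
    ((hd x (hTU hx)).continuousAt.mul (hT x hx).2).continuousWithinAt).eventuallyEq_of_mem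
      (hTo.mem_nhds hx₀T)

theorem exists_analyticAt_eq_mul_of_lintegral_div_sq {a d : E → ℂ} {x₀ : E}
    (ha : AnalyticAt ℂ a x₀) (hd : AnalyticAt ℂ d x₀) (hd0 : ¬ ∀ᶠ x in 𝓝 x₀, d x = 0)
    {s : Set E} (hs : s ∈ 𝓝 x₀) (hL : ∫⁻ x in s, ‖a x / d x‖ₑ ^ 2 ∂μ ≠ ⊤) :
    ∃ b : E → ℂ, AnalyticAt ℂ b x₀ ∧ ∀ᶠ x in 𝓝 x₀, a x = d x * b x := by
  obtain ⟨p, r₁, hp⟩ := ha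
  obtain ⟨q, r₂, hq⟩ := hd
  have hr : 0 < min r₁ r₂ := lt_min hp.r_pos hq.r_pos
  replace hp := hp.mono hr (min_le_left _ _)
  replace hq := hq.mono hr (min_le_right _ _)
  obtain ⟨ρ, hρ, hρs⟩ := Metric.mem_nhds_iff.1 (inter_mem hs (eball_mem_nhds x₀ hr))
  obtain ⟨e, heρ, ε, ⟨hε0, hε1⟩, hde⟩ := exists_forall_sphere_ne_zero hq.analyticAt hd0 hρ
  have hU : ∀ z ∈ closedBall (0 : ℂ) ε, x₀ + z • e ∈ ball x₀ ρ := fun z hz => by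
    rw [mem_ball_iff_norm, add_sub_cancel_left, norm_smul]
    exact (mul_le_of_le_one_left (norm_nonneg _)
      ((mem_closedBall_zero_iff.1 hz).trans hε1.le)).trans_lt heρ
  have hb : AnalyticAt ℂ
      (fun x => Real.circleAverage (fun z => a (x + z • e) / d (x + z • e)) 0 ε) x₀ := by
    refine analyticAt_circleAverage_div hp hq hε0.le ?_ hde
    simpa [edist_eq_enorm_sub] using (hρs (hU ε (by simp [abs_of_pos hε0]))).2
  exact ⟨_, hb, eventually_eq_mul_circleAverage_div μ isOpen_ball
    (hp.analyticOnNhd.mono fun x hx => (hρs hx).2) (hq.analyticOnNhd.mono fun x hx => (hρs hx).2)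
    (ne_top_of_le_ne_top hL (lintegral_mono_set fun x hx => (hρs hx).1)) hε0 hU hde
    (hb.eventually_analyticAt.mono fun _ hx => hx.continuousAt)⟩

theorem exists_analyticAt_eq_smul_of_lintegral_sq {ι : Type*} [Fintype ι]
    {a : E → EuclideanSpace ℂ ι} {d : E → ℂ} {x₀ : E} (ha : AnalyticAt ℂ a x₀)
    (hd : AnalyticAt ℂ d x₀) (hd0 : ¬ ∀ᶠ x in 𝓝 x₀, d x = 0) {s : Set E} (hs : s ∈ 𝓝 x₀)
    (hL : ∫⁻ x in s, ‖(d x)⁻¹ • a x‖ₑ ^ 2 ∂μ ≠ ⊤) :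
    ∃ b : E → EuclideanSpace ℂ ι, AnalyticAt ℂ b x₀ ∧ ∀ᶠ x in 𝓝 x₀, a x = d x • b x := by
  have hdiv (i : ι) : ∃ b : E → ℂ, AnalyticAt ℂ b x₀ ∧ ∀ᶠ x in 𝓝 x₀, a x i = d x * b x := by
    refine exists_analyticAt_eq_mul_of_lintegral_div_sq μ
      (((EuclideanSpace.proj i : EuclideanSpace ℂ ι →L[ℂ] ℂ).analyticAt _).comp ha) hd hd0 hs
      (ne_top_of_le_ne_top hL (lintegral_mono fun x => ?_))
    gcongr
    have hcoord : ((d x)⁻¹ • a x) i = a x i / d x := by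
      rw [div_eq_inv_mul, PiLp.smul_apply, smul_eq_mul]
    exact enorm_le_iff_norm_le.2 (hcoord ▸ PiLp.norm_apply_le ((d x)⁻¹ • a x) i)
  choose b hb hab using hdiv
  refine ⟨fun x => WithLp.toLp 2 fun i => b i x,
    ((PiLp.continuousLinearEquiv 2 ℂ fun _ : ι => ℂ).symm.toContinuousLinearMap.analyticAt
      _).comp (analyticAt_pi_iff.2 hb), ?_⟩
  filter_upwards [eventually_all.2 hab] with x hx
  ext i
  exact hx i

end Division

section InfiniteFibre

open Filter Topology Metric Module

variable {𝕜 E F : Type*} [RCLike 𝕜] [NormedAddCommGroup E] [NormedSpace 𝕜 E]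
  [FiniteDimensional 𝕜 E]

theorem exists_injOn_contDiffOn_fibre [NormedAddCommGroup F] [NormedSpace 𝕜 F]
    [FiniteDimensional 𝕜 F] {f : E → F} {x : E} (hf : ContDiffAt 𝕜 1 f x)
    (hsurj : (fderiv 𝕜 f x).range = ⊤) {O : Set E} (hO : O ∈ 𝓝 x) :
    ∃ (g : (fderiv 𝕜 f x).ker → E) (U : Set (fderiv 𝕜 f x).ker), IsOpen U ∧ U.Nonempty ∧
      ContDiffOn 𝕜 1 g U ∧ Set.InjOn g U ∧ ∀ t ∈ U, g t ∈ O ∧ f (g t) = f x := by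
  have : CompleteSpace E := FiniteDimensional.complete 𝕜 E
  have : CompleteSpace F := FiniteDimensional.complete 𝕜 F
  have hker : (fderiv 𝕜 f x).ker.ClosedComplemented :=
    ContinuousLinearMap.ker_closedComplemented_of_finiteDimensional_range _
  let φ : ImplicitFunctionData 𝕜 E F (fderiv 𝕜 f x).ker :=
    (hf.hasStrictFDerivAt one_ne_zero).implicitFunctionDataOfComplemented _ _ hsurj hker
  let t₀ := φ.rightFun x
  let g : (fderiv 𝕜 f x).ker → E := φ.implicitFunction (f x)
  have hright : ContDiffAt 𝕜 1 φ.rightFun φ.pt := by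
    change ContDiffAt 𝕜 1 (fun y => Classical.choose hker (y - x)) x
    fun_prop
  have hg : ContDiffAt 𝕜 1 g t₀ :=
    ContDiffAt.comp (f := fun t : (fderiv 𝕜 f x).ker => (f x, t)) t₀
      (φ.contDiffAt_implicitFunction hf hright one_ne_zero) (by fun_prop)
  have hgx : g t₀ = x := φ.implicitFunction_apply_image.self_of_nhds
  have htend : Tendsto (fun t : (fderiv 𝕜 f x).ker => (f x, t)) (𝓝 t₀) (𝓝 (φ.prodFun φ.pt)) :=
    Continuous.continuousAt (by fun_prop)
  have hprod : ∀ᶠ t in 𝓝 t₀, φ.prodFun (g t) = (f x, t) :=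
    htend.eventually φ.prodFun_implicitFunction
  have hgO : ∀ᶠ t in 𝓝 t₀, g t ∈ O := hg.continuousAt.eventually_mem (by rwa [hgx])
  obtain ⟨r, hr, hball⟩ := Metric.eventually_nhds_iff_ball.1
    (hprod.and ((hg.eventually (by simp)).and hgO))
  refine ⟨g, ball t₀ r, isOpen_ball, ⟨t₀, mem_ball_self hr⟩,
    fun t ht => (hball t ht).2.1.contDiffWithinAt, fun s hs t ht hst => ?_,
    fun t ht => ⟨(hball t ht).2.2, congrArg Prod.fst (hball t ht).1⟩⟩
  have hst' := (hball s hs).1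
  rw [hst, (hball t ht).1] at hst'
  exact (congrArg Prod.snd hst').symm

theorem exists_injOn_contDiffOn_level_set {O : Set E} (hO : IsOpen O) (hne : O.Nonempty)
    {f : E → 𝕜} (hf : ContDiffOn 𝕜 1 f O) :
    ∃ (K : Submodule 𝕜 E) (g : K → E) (U : Set K) (c : 𝕜), finrank 𝕜 E ≤ finrank 𝕜 K + 1 ∧
      IsOpen U ∧ U.Nonempty ∧ ContDiffOn 𝕜 1 g U ∧ Set.InjOn g U ∧
      ∀ t ∈ U, g t ∈ O ∧ f (g t) = c := by
  by_cases hz : ∀ x ∈ O, fderiv 𝕜 f x = 0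
  · obtain ⟨x, hx⟩ := hne
    obtain ⟨r, hr, hrO⟩ := Metric.isOpen_iff.1 hO x hx
    let _ : NormedSpace ℝ E := NormedSpace.restrictScalars ℝ 𝕜 E
    have hconst : ∀ y ∈ ball x r, f y = f x := fun y hy =>
      isOpen_ball.is_const_of_fderiv_eq_zero (convex_ball x r).isPreconnected
        ((hf.differentiableOn one_ne_zero).mono hrO) (fun z hz' => hz z (hrO hz')) hy
        (mem_ball_self hr)
    exact ⟨⊤, Subtype.val, Subtype.val ⁻¹' ball x r, f x, by simp,
      isOpen_ball.preimage continuous_subtype_val, ⟨⟨x, trivial⟩, mem_ball_self hr⟩,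
      (⊤ : Submodule 𝕜 E).subtypeL.contDiff.contDiffOn, Subtype.val_injective.injOn,
      fun t ht => ⟨hrO ht, hconst t ht⟩⟩
  · push Not at hz
    obtain ⟨x, hx, hL⟩ := hz
    have hsurj : (fderiv 𝕜 f x).range = ⊤ :=
      LinearMap.range_eq_top.2 <| LinearMap.surjective_of_ne_zero fun h => hL <| by
        ext v
        exact congrArg (fun l : E →ₗ[𝕜] 𝕜 => l v) h
    obtain ⟨g, U, hU, hUne, hg, hinj, hgU⟩ := exists_injOn_contDiffOn_fibre
      (hf.contDiffAt (hO.mem_nhds hx)) hsurj (hO.mem_nhds hx)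
    have hdim := LinearMap.finrank_range_add_finrank_ker (fderiv 𝕜 f x : E →ₗ[𝕜] 𝕜)
    rw [hsurj, finrank_top, finrank_self] at hdim
    exact ⟨_, g, U, f x, by omega, hU, hUne, hg, hinj, hgU⟩

theorem exists_infinite_fibre {k : ℕ} (hk : k < finrank 𝕜 E) {O : Set E} (hO : IsOpen O)
    (hne : O.Nonempty) {f : Fin k → E → 𝕜} (hf : ∀ i, ContDiffOn 𝕜 1 (f i) O) :
    ∃ c : Fin k → 𝕜, {x ∈ O | ∀ i, f i x = c i}.Infinite := by
  induction k generalizing E with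
  | zero =>
    obtain ⟨x, hx⟩ := hne
    have : Nontrivial E := nontrivial_of_finrank_pos hk
    have : (𝓝[≠] x).NeBot := Module.punctured_nhds_neBot 𝕜 E x
    exact ⟨fun i => i.elim0, by simpa using infinite_of_mem_nhds x (hO.mem_nhds hx)⟩
  | succ k ih =>
    obtain ⟨K, g, U, a, hdim, hU, hUne, hg, hinj, hgU⟩ :=
      exists_injOn_contDiffOn_level_set hO hne (hf (Fin.last k))
    obtain ⟨c, hc⟩ := ih (by omega) hU hUne
      fun i => (hf i.castSucc).comp hg fun t ht => (hgU t ht).1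
    refine ⟨Fin.snoc c a, (hc.image (hinj.mono fun t ht => ht.1)).mono ?_⟩
    rintro - ⟨t, ⟨ht, htc⟩, rfl⟩
    refine ⟨(hgU t ht).1, Fin.lastCases ?_ fun j => ?_⟩
    · simpa using (hgU t ht).2
    · simpa using htc j

end InfiniteFibre

section ChangeOfVariables

open MeasureTheory Module

variable {E : Type*} [NormedAddCommGroup E] [NormedSpace ℝ E] [FiniteDimensional ℝ E]
  [MeasurableSpace E] [BorelSpace E] (μ : Measure E) [μ.IsAddHaarMeasure]

theorem lintegral_image_le_lintegral_abs_det_fderiv_mul {f : E → E} {f' : E → E →L[ℝ] E}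
    {s : Set E} (hs : MeasurableSet s) (hf' : ∀ x ∈ s, HasFDerivWithinAt f (f' x) s x)
    (h : E → ENNReal) :
    ∫⁻ y in f '' s, h y ∂μ ≤ ∫⁻ x in s, ENNReal.ofReal |(f' x).det| * h (f x) ∂μ := by
  have hρ : AEMeasurable (fun x => ENNReal.ofReal |(f' x).det|) (μ.restrict s) :=
    aemeasurable_ofReal_abs_det_fderivWithin μ hs hf'
  have hcont : ContinuousOn f s := fun x hx => (hf' x hx).continuousWithinAt
  set ν := (μ.restrict s).withDensity fun x => ENNReal.ofReal |(f' x).det| with hν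
  have hf : AEMeasurable f ν :=
    (hcont.aemeasurable hs).mono_ac (withDensity_absolutelyContinuous _ _)
  have hle : μ.restrict (f '' s) ≤ ν.map f := by
    refine Measure.le_iff.2 fun T hT => ?_
    have hsT : MeasurableSet (s ∩ f ⁻¹' T) := by
      have := hs.subtype_image (hcont.domRestrict.measurable hT)
      rwa [Set.domRestrict_eq, Set.preimage_comp, Subtype.image_preimage_coe] at this
    rw [Measure.restrict_apply hT, Measure.map_apply_of_aemeasurable hf hT]
    calc μ (T ∩ f '' s) = μ (f '' (s ∩ f ⁻¹' T)) := by rw [Set.image_inter_preimage, Set.inter_comm]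
      _ ≤ ∫⁻ x in s ∩ f ⁻¹' T, ENNReal.ofReal |(f' x).det| ∂μ :=
        addHaar_image_le_lintegral_abs_det_fderiv μ hsT fun x hx =>
          (hf' x hx.1).mono Set.inter_subset_left
      _ = ν (s ∩ f ⁻¹' T) := by
        rw [hν, withDensity_apply _ hsT, Measure.restrict_restrict hsT,
          Set.inter_eq_self_of_subset_left Set.inter_subset_left]
      _ ≤ ν (f ⁻¹' T) := measure_mono Set.inter_subset_right
  calc ∫⁻ y in f '' s, h y ∂μ ≤ ∫⁻ y, h y ∂(ν.map f) := lintegral_mono' hle le_rfl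
    _ ≤ ∫⁻ x, h (f x) ∂ν := lintegral_map_le _ _
    _ = _ := lintegral_withDensity_eq_lintegral_mul_non_measurable₀ _ hρ
        (Filter.Eventually.of_forall fun _ => ENNReal.ofReal_lt_top) _

end ChangeOfVariables

section ComplexJacobian

open MeasureTheory Module

variable {E : Type*} [NormedAddCommGroup E] [NormedSpace ℂ E]

theorem abs_det_restrictScalars (L : E →L[ℂ] E) :
    |(L.restrictScalars ℝ).det| = ‖L.det‖ ^ 2 := by
  have h : (L.restrictScalars ℝ).det = Algebra.norm ℝ L.det :=
    LinearMap.det_restrictScalars (R := ℝ) (S := ℂ) (f := (L : E →ₗ[ℂ] E))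
  rw [h, Algebra.norm_complex_apply, Complex.normSq_eq_norm_sq, abs_of_nonneg (by positivity)]

variable [FiniteDimensional ℂ E]
  [MeasurableSpace E] [BorelSpace E] (μ : Measure E) [μ.IsAddHaarMeasure]

theorem lintegral_image_le_lintegral_norm_det_sq_mul {f : E → E} {f' : E → E →L[ℂ] E}
    {s : Set E} (hs : MeasurableSet s) (hf' : ∀ x ∈ s, HasFDerivAt f (f' x) x) (h : E → ENNReal) :
    ∫⁻ y in f '' s, h y ∂μ ≤ ∫⁻ x in s, ‖(f' x).det‖ₑ ^ 2 * h (f x) ∂μ := by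
  refine (lintegral_image_le_lintegral_abs_det_fderiv_mul μ hs
    (fun x hx => ((hf' x hx).restrictScalars ℝ).hasFDerivWithinAt) h).trans_eq ?_
  congr 1
  ext x
  rw [abs_det_restrictScalars, ← ofReal_norm, ENNReal.ofReal_pow (norm_nonneg _)]

/-- **Sard's lemma** for holomorphic maps that do not decrease dimension. -/
theorem measure_image_eq_zero_of_not_surjective {D : Type*} [NormedAddCommGroup D]
    [NormedSpace ℂ D] [FiniteDimensional ℂ D] (hdim : finrank ℂ D ≤ finrank ℂ E)
    {f : D → E} {f' : D → D →L[ℂ] E} {s : Set D} (hf' : ∀ x ∈ s, HasFDerivAt f (f' x) x)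
    (hs : ∀ x ∈ s, ¬ Function.Surjective (f' x)) : μ (f '' s) = 0 := by
  obtain ⟨j, hj⟩ := finrank_le_iff_exists_linearMap.1 hdim
  obtain ⟨q, hq⟩ := j.exists_leftInverse_of_injective (LinearMap.ker_eq_bot.2 hj)
  let ϖ : E →L[ℂ] D := q.toContinuousLinearMap
  have hϖ : Function.Surjective ϖ := fun x => ⟨j x, congrArg (fun f : D →ₗ[ℂ] D => f x) hq⟩
  have himage : f '' s = (fun y => f (ϖ y)) '' (ϖ ⁻¹' s) := by
    rw [← Set.image_image f ϖ, Set.image_preimage_eq _ hϖ]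
  rw [himage]
  refine addHaar_image_eq_zero_of_det_fderivWithin_eq_zero μ
    (f' := fun y => ((f' (ϖ y)).comp ϖ).restrictScalars ℝ) (fun y hy => ?_) fun y hy => ?_
  · exact (((hf' _ hy).comp y ϖ.hasFDerivAt).restrictScalars ℝ).hasFDerivWithinAt
  · by_contra hdet
    have hdet_sq : ‖((f' (ϖ y)).comp ϖ).det‖ ^ 2 ≠ 0 := by
      rw [← abs_det_restrictScalars]
      exact abs_ne_zero.2 hdet
    have hdet' : LinearMap.det (((f' (ϖ y)).comp ϖ : E →L[ℂ] E) : E →ₗ[ℂ] E) ≠ 0 := fun h =>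
      hdet_sq (by rw [ContinuousLinearMap.det, h]; simp)
    have hsurj : Function.Surjective (f' (ϖ y) ∘ ϖ) :=
      (LinearMap.equivOfDetNeZero _ hdet').surjective
    exact hs _ hy hsurj.of_comp

end ComplexJacobian

section Coordinates

open Filter Topology

variable {n : ℕ} {M : Type*} [TopologicalSpace M] [ChartedSpace (ℂ^n) M]

/-- The domain of the chart of `M` around `x₀`. -/
def chartDomain (n : ℕ) {M : Type*} [TopologicalSpace M] [ChartedSpace (ℂ^n) M] (x₀ : M) :
    Opens M :=
  ⟨(chartAt (ℂ^n) x₀).source, (chartAt (ℂ^n) x₀).open_source⟩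

theorem mem_chartDomain_self (x₀ : M) : x₀ ∈ chartDomain n x₀ :=
  mem_chart_source _ x₀

theorem coe_chartDomain (x₀ : M) :
    (chartDomain n x₀ : Set M) = (extChartAt (modelC n) x₀).source :=
  (extChartAt_source (modelC n) x₀).symm

theorem extChartAt_left_inv {x₀ x : M} (hx : x ∈ chartDomain n x₀) :
    (extChartAt (modelC n) x₀).symm (extChartAt (modelC n) x₀ x) = x :=
  (extChartAt (modelC n) x₀).left_inv (by rwa [extChartAt_source])

theorem extChartAt_mem_target {x₀ x : M} (hx : x ∈ chartDomain n x₀) :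
    extChartAt (modelC n) x₀ x ∈ (extChartAt (modelC n) x₀).target :=
  (extChartAt (modelC n) x₀).map_source (by rwa [extChartAt_source])

theorem extChartAt_symm_mem_chartDomain {x₀ : M} {z : ℂ^n}
    (hz : z ∈ (extChartAt (modelC n) x₀).target) :
    (extChartAt (modelC n) x₀).symm z ∈ chartDomain n x₀ := by
  rw [← SetLike.mem_coe, coe_chartDomain]
  exact (extChartAt (modelC n) x₀).map_target hz

theorem tendsto_extChartAt_symm (x₀ : M) :
    Tendsto (extChartAt (modelC n) x₀).symm (𝓝 (extChartAt (modelC n) x₀ x₀)) (𝓝 x₀) := by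
  simpa only [ContinuousAt, extChartAt_to_inv] using continuousAt_extChartAt_symm (I := modelC n) x₀

variable [IsManifold (modelC n) ω M]

/-- The vector field `X` is holomorphic on `V`, i.e. `X ∈ T_M(V)`. -/
abbrev IsHolField (V : Opens M) (X : Π x, TanC n M x) : Prop :=
  IsHolSection (n := n) (ℂ^n) (TanC n M) V X

/-- The `1`-form `θ` is holomorphic on `V`, i.e. `θ ∈ Ω_M(V)`. -/
abbrev IsHolForm (V : Opens M) (θ : Π x, CotC n M x) : Prop :=
  IsHolSection (n := n) (ℂ^n →L[ℂ] ℂ) (CotC n M) V θ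

/-- Coordinates of tangent vectors at `x` in the chart around `x₀`. -/
noncomputable def toCoord (x₀ x : M) : TanC n M x →L[ℂ] ℂ^n :=
  (trivializationAt (ℂ^n) (TanC n M) x₀).continuousLinearMapAt ℂ x

/-- The tangent vector at `x` with given coordinates in the chart around `x₀`. -/
noncomputable def ofCoord (x₀ x : M) : ℂ^n →L[ℂ] TanC n M x :=
  (trivializationAt (ℂ^n) (TanC n M) x₀).symmL ℂ x

/-- Coordinates of a cotangent vector at `x` in the chart around `x₀`. -/
noncomputable def formCoord (x₀ x : M) (θ : CotC n M x) : ℂ^n →L[ℂ] ℂ := by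
  exact θ.comp (ofCoord x₀ x)

section
variable {x₀ x : M} (hx : x ∈ chartDomain n x₀)
include hx

theorem mem_baseSet_trivializationAt :
    x ∈ (trivializationAt (ℂ^n) (TanC n M) x₀).baseSet := by
  rwa [TangentBundle.trivializationAt_baseSet]

theorem toCoord_ofCoord (v : ℂ^n) : toCoord x₀ x (ofCoord x₀ x v) = v :=
  Trivialization.continuousLinearMapAt_symmL _ (mem_baseSet_trivializationAt hx) v

theorem ofCoord_toCoord (v : TanC n M x) : ofCoord x₀ x (toCoord x₀ x v) = v :=
  Trivialization.symmL_continuousLinearMapAt _ (mem_baseSet_trivializationAt hx) v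

theorem toCoord_bijective : Function.Bijective (toCoord (n := n) x₀ x) :=
  Function.bijective_iff_has_inverse.2 ⟨ofCoord x₀ x, ofCoord_toCoord hx, toCoord_ofCoord hx⟩

theorem ofCoord_bijective : Function.Bijective (ofCoord (n := n) x₀ x) :=
  Function.bijective_iff_has_inverse.2 ⟨toCoord x₀ x, toCoord_ofCoord hx, ofCoord_toCoord hx⟩

theorem hasMFDerivAt_extChartAt_toCoord :
    HasMFDerivAt (modelC n) (modelC n) (extChartAt (modelC n) x₀) x (toCoord x₀ x) := by
  have : IsManifold (modelC n) 1 M := IsManifold.of_le (n := ω) le_top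
  rw [toCoord, TangentBundle.continuousLinearMapAt_trivializationAt hx]
  exact (mdifferentiableAt_extChartAt hx).hasMFDerivAt

theorem hasMFDerivAt_extChartAt_symm_ofCoord :
    HasMFDerivAt (modelC n) (modelC n) (extChartAt (modelC n) x₀).symm
      (extChartAt (modelC n) x₀ x) (ofCoord x₀ x) := by
  have : IsManifold (modelC n) 1 M := IsManifold.of_le (n := ω) le_top
  have hderiv := (mdifferentiableWithinAt_extChartAt_symm (I := modelC n)
    (extChartAt_mem_target hx)).hasMFDerivWithinAt
  rw [← TangentBundle.symmL_trivializationAt hx, ModelWithCorners.range_eq_univ] at hderiv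
  exact hasMFDerivWithinAt_univ.1 hderiv

end

theorem isHolField_iff {V : Opens M} {x₀ : M} (hV : V ≤ chartDomain n x₀)
    {X : Π x, TanC n M x} :
    IsHolField V X ↔
      ContMDiffOn (modelC n) (modelC n) ω (fun x => toCoord x₀ x (X x)) V := by
  rw [IsHolField, IsHolSection, Trivialization.contMDiffOn_section_iff
    (trivializationAt (ℂ^n) (TanC n M) x₀) V.isOpen
    (fun x hx => mem_baseSet_trivializationAt (hV hx))]
  refine contMDiffOn_congr fun x hx => ?_
  rw [toCoord, Trivialization.continuousLinearMapAt_apply_of_mem _ _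
    (mem_baseSet_trivializationAt (hV hx))]

theorem formCoord_apply (x₀ x : M) (θ : CotC n M x) (v : ℂ^n) :
    formCoord x₀ x θ v = θ (ofCoord x₀ x v) := rfl

theorem isHolForm_iff {V : Opens M} {x₀ : M} (hV : V ≤ chartDomain n x₀)
    {θ : Π x, CotC n M x} :
    IsHolForm V θ ↔ ContMDiffOn (modelC n) (modelWithCornersSelf ℂ (ℂ^n →L[ℂ] ℂ)) ω
      (fun x => formCoord x₀ x (θ x)) V := by
  rw [IsHolForm, IsHolSection, Trivialization.contMDiffOn_section_iff
    (trivializationAt (ℂ^n →L[ℂ] ℂ) (CotC n M) x₀) V.isOpen (fun _ _ => ?_)]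
  · refine contMDiffOn_congr fun x _ => ?_
    rw [hom_trivializationAt_apply]
    ext v
    simp [ContinuousLinearMap.inCoordinates, formCoord_apply, ofCoord]
  · rw [hom_trivializationAt_baseSet]
    exact ⟨mem_baseSet_trivializationAt (hV ‹_›), trivial⟩

theorem IsHolSection.isHolFun_apply {V : Opens M} {θ : Π x, CotC n M x} {X : Π x, TanC n M x}
    (hθ : IsHolForm V θ) (hX : IsHolField V X) : IsHolFun (n := n) V (fun x => θ x (X x)) :=
  fun x hx => contMDiffWithinAt_section.1 (ContMDiffOn.clm_bundle_apply hθ hX x hx)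

theorem isOpen_inter_setOf_toCoord_ne_zero {V : Opens M} {x₀ : M} (hV : V ≤ chartDomain n x₀)
    {X : Π x, TanC n M x} (hX : IsHolField V X) :
    IsOpen ((V : Set M) ∩ {x | toCoord x₀ x (X x) ≠ 0}) :=
  ((isHolField_iff hV).1 hX).continuousOn.isOpen_inter_preimage V.isOpen isOpen_compl_singleton

variable {F : Type*} [NormedAddCommGroup F] [NormedSpace ℂ F] {x₀ x : M}

theorem analyticAt_comp_extChartAt_symm (hx : x ∈ chartDomain n x₀) {f : M → F}
    (hf : ContMDiffAt (modelC n) (modelWithCornersSelf ℂ F) ω f x) :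
    AnalyticAt ℂ (f ∘ (extChartAt (modelC n) x₀).symm) (extChartAt (modelC n) x₀ x) := by
  have hsymm : ContMDiffAt (modelC n) (modelC n) ω (extChartAt (modelC n) x₀).symm
      (extChartAt (modelC n) x₀ x) :=
    (contMDiffOn_extChartAt_symm x₀).contMDiffAt
      ((isOpen_extChartAt_target x₀).mem_nhds (extChartAt_mem_target hx))
  rw [← extChartAt_left_inv hx] at hf
  exact (hf.comp _ hsymm).contDiffAt.analyticAt

theorem contMDiffAt_comp_extChartAt [CompleteSpace F] (hx : x ∈ chartDomain n x₀) {g : ℂ^n → F}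
    (hg : AnalyticAt ℂ g (extChartAt (modelC n) x₀ x)) :
    ContMDiffAt (modelC n) (modelWithCornersSelf ℂ F) ω (g ∘ extChartAt (modelC n) x₀) x :=
  hg.contDiffAt.contMDiffAt.comp x (contMDiffAt_extChartAt' hx)

end Coordinates

section Jacobian

open Filter Topology

variable {m n : ℕ} {M : Type*} [TopologicalSpace M] [ChartedSpace (ℂ^m) M]
  {N : Type*} [TopologicalSpace N] [ChartedSpace (ℂ^n) N] {η : M → N}

/-- The map `η` written in the charts around `x₀` and `y₀`. -/
noncomputable def coordMap (η : M → N) (x₀ : M) (y₀ : N) : ℂ^m → ℂ^n :=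
  fun z => extChartAt (modelC n) y₀ (η ((extChartAt (modelC m) x₀).symm z))

theorem coordMap_extChartAt (η : M → N) {x₀ x : M} (y₀ : N) (hx : x ∈ chartDomain m x₀) :
    coordMap η x₀ y₀ (extChartAt (modelC m) x₀ x) = extChartAt (modelC n) y₀ (η x) := by
  rw [coordMap, extChartAt_left_inv hx]

theorem exists_opens_le_chartDomain (hη : Continuous η) {V : Opens M} {O : Opens N}
    (hV : Set.MapsTo η V O) {x₀ : M} (hx₀ : x₀ ∈ V) :
    ∃ T ≤ V ⊓ chartDomain m x₀, x₀ ∈ T ∧ Set.MapsTo η T (O ⊓ chartDomain n (η x₀) : Opens N) :=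
  ⟨V ⊓ chartDomain m x₀ ⊓ (chartDomain n (η x₀)).comap ⟨η, hη⟩, inf_le_left,
    ⟨⟨hx₀, mem_chartDomain_self x₀⟩, mem_chartDomain_self (η x₀)⟩,
    fun _ hx => ⟨hV hx.1.1, hx.2⟩⟩

variable [IsManifold (modelC m) ω M] [IsManifold (modelC n) ω N]

/-- The differential of `η` at `x` in the charts around `x₀` and `y₀`. -/
noncomputable def jacobian (η : M → N) (x₀ : M) (y₀ : N) (x : M) : ℂ^m →L[ℂ] ℂ^n :=
  (toCoord y₀ (η x)).comp ((mfderiv (modelC m) (modelC n) η x).comp (ofCoord x₀ x))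

section

variable {x₀ x : M} {y₀ : N}

theorem jacobian_toCoord (hx : x ∈ chartDomain m x₀) (u : TanC m M x) :
    jacobian (n := n) η x₀ y₀ x (toCoord x₀ x u) =
      toCoord y₀ (η x) (mfderiv (modelC m) (modelC n) η x u) :=
  congrArg (fun v => toCoord y₀ (η x) (mfderiv (modelC m) (modelC n) η x v)) (ofCoord_toCoord hx u)

theorem ofCoord_jacobian (hy : η x ∈ chartDomain n y₀) (v : ℂ^m) :
    ofCoord y₀ (η x) (jacobian η x₀ y₀ x v) =
      mfderiv (modelC m) (modelC n) η x (ofCoord x₀ x v) :=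
  ofCoord_toCoord hy _

theorem surjective_jacobian_iff (hx : x ∈ chartDomain m x₀) (hy : η x ∈ chartDomain n y₀) :
    Function.Surjective (jacobian (m := m) (n := n) η x₀ y₀ x) ↔
      Function.Surjective (mfderiv (modelC m) (modelC n) η x) :=
  (Function.Surjective.of_comp_iff' (toCoord_bijective hy) _).trans
    (Function.Surjective.of_comp_iff _ (ofCoord_bijective hx).surjective)

theorem injective_jacobian_iff (hx : x ∈ chartDomain m x₀) (hy : η x ∈ chartDomain n y₀) :
    Function.Injective (jacobian (m := m) (n := n) η x₀ y₀ x) ↔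
      Function.Injective (mfderiv (modelC m) (modelC n) η x) :=
  (Function.Injective.of_comp_iff (toCoord_bijective hy).injective _).trans
    (Function.Injective.of_comp_iff' _ (ofCoord_bijective hx))

theorem formCoord_pullbackForm (hy : η x ∈ chartDomain n y₀) (θ : Π y, CotC n N y) :
    formCoord x₀ x (pullbackForm (m := m) η θ x) =
      (formCoord y₀ (η x) (θ (η x))).comp (jacobian (m := m) η x₀ y₀ x) := by
  ext v
  rw [ContinuousLinearMap.comp_apply, formCoord_apply, formCoord_apply, ofCoord_jacobian hy]
  rfl

variable (hη : ContMDiff (modelC m) (modelC n) ω η)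
include hη

theorem hasFDerivAt_coordMap (hx : x ∈ chartDomain m x₀) (hy : η x ∈ chartDomain n y₀) :
    HasFDerivAt (coordMap (n := n) η x₀ y₀) (jacobian η x₀ y₀ x) (extChartAt (modelC m) x₀ x) := by
  have hcomp : HasMFDerivAt (modelC m) (modelC n) (extChartAt (modelC n) y₀ ∘ η)
      ((extChartAt (modelC m) x₀).symm (extChartAt (modelC m) x₀ x))
      ((toCoord y₀ (η x)).comp (mfderiv (modelC m) (modelC n) η x)) := by
    rw [extChartAt_left_inv hx]
    exact (hasMFDerivAt_extChartAt_toCoord hy).comp x (hη.mdifferentiableAt (by simp)).hasMFDerivAt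
  exact (hcomp.comp _ (hasMFDerivAt_extChartAt_symm_ofCoord hx)).hasFDerivAt

theorem analyticAt_coordMap (hx : x ∈ chartDomain m x₀) (hy : η x ∈ chartDomain n y₀) :
    AnalyticAt ℂ (coordMap (n := n) η x₀ y₀) (extChartAt (modelC m) x₀ x) :=
  analyticAt_comp_extChartAt_symm hx ((contMDiffAt_extChartAt' hy).comp x hη.contMDiffAt)

theorem contMDiffAt_jacobian (hx : x ∈ chartDomain m x₀) (hy : η x ∈ chartDomain n y₀) :
    ContMDiffAt (modelC m) (modelWithCornersSelf ℂ (ℂ^m →L[ℂ] ℂ^n)) ω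
      (jacobian (m := m) (n := n) η x₀ y₀) x := by
  refine (contMDiffAt_comp_extChartAt hx (analyticAt_coordMap hη hx hy).fderiv)
    |>.congr_of_eventuallyEq ?_
  filter_upwards [(chartDomain m x₀).isOpen.mem_nhds hx,
    hη.continuous.continuousAt.eventually_mem ((chartDomain n y₀).isOpen.mem_nhds hy)] with z hz hηz
  exact (hasFDerivAt_coordMap hη hz hηz).fderiv.symm

end

theorem isHolForm_pullbackForm (hη : ContMDiff (modelC m) (modelC n) ω η) {O : Opens N}
    {θ : Π y, CotC n N y} (hθ : IsHolForm (n := n) O θ) {V : Opens M} (hV : Set.MapsTo η V O) :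
    IsHolForm V (pullbackForm (m := m) η θ) := by
  refine IsHolSection.of_locally fun x₀ hx₀ => ?_
  obtain ⟨T, hTV, hx₀T, hTO⟩ := exists_opens_le_chartDomain (m := m) (n := n) hη.continuous hV hx₀
  refine ⟨T, hTV.trans inf_le_left, hx₀T, _, (isHolForm_iff (hTV.trans inf_le_right)).2 ?_,
    fun _ _ => rfl⟩
  have hθcoord := (isHolForm_iff inf_le_right).1 (hθ.mono (inf_le_left (b := chartDomain n (η x₀))))
  intro x hx
  have hcomp := (hθcoord.contMDiffAt ((O ⊓ chartDomain n (η x₀)).isOpen.mem_nhds (hTO hx))).comp x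
    hη.contMDiffAt
  have hjac := contMDiffAt_jacobian hη (hTV hx).2 (hTO hx).2
  refine ((hcomp.clm_comp hjac).congr_of_eventuallyEq ?_).contMDiffWithinAt
  filter_upwards [T.isOpen.mem_nhds hx] with z hz
  exact formCoord_pullbackForm (hTO hz).2 θ

end Jacobian

section Dimension

open Filter Topology MeasureTheory Module

variable {m n : ℕ} {M : Type*} [TopologicalSpace M] [ChartedSpace (ℂ^m) M]
  [IsManifold (modelC m) ω M] {N : Type*} [TopologicalSpace N] [ChartedSpace (ℂ^n) N]
  [IsManifold (modelC n) ω N] {η : M → N}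

theorem measure_extChartAt_image_eq_zero (μ : Measure (ℂ^n)) [μ.IsAddHaarMeasure] (hmn : m ≤ n)
    (hη : ContMDiff (modelC m) (modelC n) ω η) {x₀ : M} {y₀ : N} {B : Set M}
    (hB : B ⊆ chartDomain m x₀) (hηB : Set.MapsTo η B (chartDomain n y₀))
    (hs : ∀ x ∈ B, ¬ Function.Surjective (mfderiv (modelC m) (modelC n) η x)) :
    μ (extChartAt (modelC n) y₀ '' (η '' B)) = 0 := by
  have himage : extChartAt (modelC n) y₀ '' (η '' B) =
      coordMap η x₀ y₀ '' (extChartAt (modelC m) x₀ '' B) := by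
    rw [Set.image_image, Set.image_image]
    exact Set.image_congr fun x hx => (coordMap_extChartAt η y₀ (hB hx)).symm
  rw [himage]
  refine measure_image_eq_zero_of_not_surjective μ (by simpa using hmn)
    (f' := fun z => jacobian η x₀ y₀ ((extChartAt (modelC m) x₀).symm z)) ?_ ?_
  · rintro - ⟨x, hx, rfl⟩
    rw [extChartAt_left_inv (hB hx)]
    exact hasFDerivAt_coordMap hη (hB hx) (hηB hx)
  · rintro - ⟨x, hx, rfl⟩
    rw [extChartAt_left_inv (hB hx), surjective_jacobian_iff (hB hx) (hηB hx)]
    exact hs x hx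

theorem exists_surjective_mfderiv (hmn : m ≤ n) (hη : ContMDiff (modelC m) (modelC n) ω η)
    (hproper : IsProperMap η) (hsurj : Function.Surjective η) {O : Opens N}
    (hO : (O : Set N).Nonempty) :
    ∃ x, η x ∈ O ∧ Function.Surjective (mfderiv (modelC m) (modelC n) η x) := by
  by_contra! hcrit
  obtain ⟨y₀, hy₀⟩ := hO
  have : LocallyCompactSpace N := Manifold.locallyCompact_of_finiteDimensional (modelC n)
  obtain ⟨K, hK, hKO, hKc⟩ := local_compact_nhds
    ((O ⊓ chartDomain n y₀).isOpen.mem_nhds ⟨hy₀, mem_chartDomain_self y₀⟩)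
  let μ : Measure (ℂ^n) := Measure.addHaar
  have hnull : μ (extChartAt (modelC n) y₀ '' (η '' (η ⁻¹' K))) = 0 := by
    refine (hproper.isCompact_preimage hKc).induction_on
      (p := fun B => μ (extChartAt (modelC n) y₀ '' (η '' B)) = 0) (by simp)
      (fun A B hAB hB => measure_mono_null (Set.image_mono (Set.image_mono hAB)) hB)
      (fun A B hA hB => ?_) fun x₀ _ => ?_
    · rw [Set.image_union, Set.image_union, measure_union_null hA hB]
    · refine ⟨η ⁻¹' K ∩ chartDomain m x₀, inter_mem_nhdsWithin _
        ((chartDomain m x₀).isOpen.mem_nhds (mem_chartDomain_self x₀)), ?_⟩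
      exact measure_extChartAt_image_eq_zero μ hmn hη Set.inter_subset_right
        (fun x hx => (hKO hx.1).2) fun x hx => hcrit x (hKO hx.1).1
  rw [Set.image_preimage_eq _ hsurj] at hnull
  exact (Measure.measure_pos_of_mem_nhds μ
    (extChartAt_image_nhds_mem_nhds_of_boundaryless hK)).ne' hnull

theorem dim_le_of_finite_fibres [Nonempty M] (hη : ContMDiff (modelC m) (modelC n) ω η)
    (hfin : ∀ y, (η ⁻¹' {y}).Finite) : m ≤ n := by
  by_contra! hmn
  obtain ⟨x₀⟩ := ‹Nonempty M›
  let P : Set (ℂ^m) := (extChartAt (modelC m) x₀).target ∩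
    (extChartAt (modelC m) x₀).symm ⁻¹' (η ⁻¹' chartDomain n (η x₀))
  have hP : IsOpen P := (continuousOn_extChartAt_symm x₀).isOpen_inter_preimage
    (isOpen_extChartAt_target x₀) ((chartDomain n (η x₀)).isOpen.preimage hη.continuous)
  have hPne : P.Nonempty := ⟨extChartAt (modelC m) x₀ x₀, mem_extChartAt_target x₀, by
    rw [Set.mem_preimage, extChartAt_to_inv]
    exact mem_chartDomain_self (η x₀)⟩
  have hsmooth : ∀ i : Fin n, ContDiffOn ℂ 1 (fun z => coordMap η x₀ (η x₀) z i) P := by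
    rintro i z ⟨hz, hηz⟩
    have hdiff := analyticAt_coordMap hη (extChartAt_symm_mem_chartDomain hz) hηz
    rw [(extChartAt (modelC m) x₀).right_inv hz] at hdiff
    exact ((EuclideanSpace.proj (𝕜 := ℂ) i).contDiff.contDiffAt.comp z
      hdiff.contDiffAt).contDiffWithinAt
  obtain ⟨c, hc⟩ := exists_infinite_fibre (by simpa using hmn) hP hPne hsmooth
  refine (hc.image ((extChartAt (modelC m) x₀).symm.injOn.mono fun z hz => hz.1.1))
    ((hfin ((extChartAt (modelC n) (η x₀)).symm (WithLp.toLp 2 c))).subset ?_)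
  rintro - ⟨z, ⟨⟨-, hηz⟩, hzc⟩, rfl⟩
  have hcoord : coordMap η x₀ (η x₀) z = WithLp.toLp 2 c := by
    ext i
    exact hzc i
  rw [Set.mem_preimage, Set.mem_singleton_iff, ← hcoord, coordMap, extChartAt_left_inv hηz]

theorem IsFiniteSurjective.dim_eq [Nonempty M] (hη : IsFiniteSurjective m n η) : m = n := by
  have hle : m ≤ n := dim_le_of_finite_fibres hη.isHol hη.finite_fibres
  obtain ⟨x₀⟩ := ‹Nonempty M›
  obtain ⟨x, -, hx⟩ := exists_surjective_mfderiv hle hη.isHol hη.isProper hη.surjective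
    (O := ⊤) ⟨η x₀, trivial⟩
  have hge := LinearMap.finrank_le_finrank_of_surjective
    (f := (jacobian (m := m) (n := n) η x (η x) x).toLinearMap)
    ((surjective_jacobian_iff (mem_chartDomain_self x) (mem_chartDomain_self _)).2 hx)
  rw [finrank_euclideanSpace_fin, finrank_euclideanSpace_fin] at hge
  exact hle.antisymm hge

end Dimension

section Adjugate

open Module

variable {𝕜 : Type*} [NontriviallyNormedField 𝕜]
  {E : Type*} [NormedAddCommGroup E] [NormedSpace 𝕜 E] [FiniteDimensional 𝕜 E]

theorem bijective_iff_det_ne_zero (L : E →L[𝕜] E) : Function.Bijective L ↔ L.det ≠ 0 :=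
  ⟨fun h => (LinearEquiv.ofBijective L.toLinearMap h).isUnit_det'.ne_zero,
    fun h => (LinearMap.equivOfDetNeZero L.toLinearMap h).bijective⟩

theorem contDiff_matrix_det {X ι : Type*} [NormedAddCommGroup X] [NormedSpace 𝕜 X] [Fintype ι]
    [DecidableEq ι] {k : WithTop ℕ∞} {A : X → Matrix ι ι 𝕜}
    (hA : ∀ i j, ContDiff 𝕜 k fun x => A x i j) : ContDiff 𝕜 k fun x => (A x).det := by
  simp only [Matrix.det_apply']
  exact ContDiff.sum fun σ _ => contDiff_const.mul (contDiff_prod fun i _ => hA _ _)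

variable [CompleteSpace 𝕜]

/-- The adjugate of an endomorphism: its matrix in a basis is the adjugate of the matrix of `L`. -/
noncomputable def adjugate (L : E →L[𝕜] E) : E →L[𝕜] E :=
  (Matrix.toLin (finBasis 𝕜 E) (finBasis 𝕜 E)
    (LinearMap.toMatrix (finBasis 𝕜 E) (finBasis 𝕜 E) L.toLinearMap).adjugate).toContinuousLinearMap

theorem adjugate_apply_self (L : E →L[𝕜] E) (v : E) : adjugate L (L v) = L.det • v := by
  set b := finBasis 𝕜 E
  have hL : Matrix.toLin b b (LinearMap.toMatrix b b L.toLinearMap) = L.toLinearMap :=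
    Matrix.toLin_toMatrix b b _
  have hdet : (LinearMap.toMatrix b b L.toLinearMap).det = L.det := LinearMap.det_toMatrix b _
  change Matrix.toLin b b _ (L.toLinearMap v) = _
  conv_lhs => rw [← hL]
  rw [LinearMap.toMatrix_toLin, ← Matrix.toLin_mul_apply, Matrix.adjugate_mul, hdet]
  simp

theorem self_apply_adjugate (L : E →L[𝕜] E) (v : E) : L (adjugate L v) = L.det • v := by
  set b := finBasis 𝕜 E
  have hL : Matrix.toLin b b (LinearMap.toMatrix b b L.toLinearMap) = L.toLinearMap :=
    Matrix.toLin_toMatrix b b _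
  have hdet : (LinearMap.toMatrix b b L.toLinearMap).det = L.det := LinearMap.det_toMatrix b _
  change L.toLinearMap (Matrix.toLin b b _ v) = _
  conv_lhs => rw [← hL]
  rw [LinearMap.toMatrix_toLin, ← Matrix.toLin_mul_apply, Matrix.mul_adjugate, hdet]
  simp

theorem contDiff_toMatrix_apply {k : WithTop ℕ∞} (i j : Fin (finrank 𝕜 E)) :
    ContDiff 𝕜 k fun L : E →L[𝕜] E =>
      LinearMap.toMatrix (finBasis 𝕜 E) (finBasis 𝕜 E) L.toLinearMap i j := by
  simp only [LinearMap.toMatrix_apply]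
  exact ((finBasis 𝕜 E).coord i).toContinuousLinearMap.contDiff.comp
    (ContinuousLinearMap.apply 𝕜 E (finBasis 𝕜 E j)).contDiff

theorem contDiff_det {k : WithTop ℕ∞} :
    ContDiff 𝕜 k (ContinuousLinearMap.det : (E →L[𝕜] E) → 𝕜) := by
  have hdet : (ContinuousLinearMap.det : (E →L[𝕜] E) → 𝕜) = fun L =>
      (LinearMap.toMatrix (finBasis 𝕜 E) (finBasis 𝕜 E) L.toLinearMap).det :=
    funext fun L => (LinearMap.det_toMatrix _ _).symm
  rw [hdet]
  exact contDiff_matrix_det contDiff_toMatrix_apply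

theorem contDiff_adjugate {k : WithTop ℕ∞} :
    ContDiff 𝕜 k (adjugate : (E →L[𝕜] E) → E →L[𝕜] E) := by
  let toCLM : (Fin (finrank 𝕜 E) → Fin (finrank 𝕜 E) → 𝕜) →ₗ[𝕜] E →L[𝕜] E :=
    LinearMap.toContinuousLinearMap.toLinearMap ∘ₗ
      (Matrix.toLin (finBasis 𝕜 E) (finBasis 𝕜 E)).toLinearMap
  refine toCLM.toContinuousLinearMap.contDiff.comp (g := toCLM.toContinuousLinearMap)
    (f := fun L : E →L[𝕜] E =>
      (LinearMap.toMatrix (finBasis 𝕜 E) (finBasis 𝕜 E) L.toLinearMap).adjugate)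
    (contDiff_pi.2 fun i => contDiff_pi.2 fun j => ?_)
  simp only [Matrix.adjugate_apply]
  refine contDiff_matrix_det fun i' j' => ?_
  by_cases h : i' = j
  · simp only [h, Matrix.updateRow_self]
    exact contDiff_const
  · simp only [Matrix.updateRow_ne h]
    exact contDiff_toMatrix_apply i' j'

end Adjugate

section LinearIndependence

variable {𝕜 : Type*} [NontriviallyNormedField 𝕜] [CompleteSpace 𝕜]
  {E : Type*} [NormedAddCommGroup E] [NormedSpace 𝕜 E] {X ι : Type*} [TopologicalSpace X]

theorem exists_isOpen_linearIndepOn_span [Finite ι] {O : Set X} (hO : IsOpen O)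
    (hne : O.Nonempty) {v : ι → X → E} (hv : ∀ i, ContinuousOn (v i) O) :
    ∃ O' ⊆ O, IsOpen O' ∧ O'.Nonempty ∧ ∃ I : Set ι, ∀ x ∈ O',
      LinearIndepOn 𝕜 (fun i => v i x) I ∧
        ∀ j, v j x ∈ Submodule.span 𝕜 ((fun i => v i x) '' I) := by
  obtain ⟨x₀, hx₀⟩ := hne
  obtain ⟨I, ⟨x, hx, hI⟩, hmax⟩ :=
    (Set.toFinite {I : Set ι | ∃ x ∈ O, LinearIndepOn 𝕜 (fun i => v i x) I}).exists_maximal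
      ⟨∅, x₀, hx₀, linearIndepOn_empty 𝕜 _⟩
  have hcont : ContinuousOn (fun x => fun i : I => v i x) O := continuousOn_pi.2 fun i => hv i
  refine ⟨O ∩ (fun x => fun i : I => v i x) ⁻¹' {f | LinearIndependent 𝕜 f},
    Set.inter_subset_left, hcont.isOpen_inter_preimage hO isOpen_setOfPred_linearIndependent,
    ⟨x, hx, hI⟩, I, fun z hz => ⟨hz.2, fun j => ?_⟩⟩
  by_contra hj
  have hindep : LinearIndepOn 𝕜 (fun i => v i z) I := hz.2
  have hsub : insert j I ⊆ I := hmax ⟨z, hz.1, hindep.insert hj⟩ (Set.subset_insert j I)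
  exact hj (Submodule.subset_span ⟨j, hsub (Set.mem_insert j I), rfl⟩)

end LinearIndependence

section Subsheaf

variable {n : ℕ} {M : Type*} [TopologicalSpace M] [ChartedSpace (ℂ^n) M]
  {F : Type*} [NormedAddCommGroup F] [NormedSpace ℂ F]
  {E : M → Type*} [TopologicalSpace (TotalSpace F E)] [∀ x, TopologicalSpace (E x)]
  [FiberBundle F E] [∀ x, AddCommGroup (E x)] [∀ x, Module ℂ (E x)]
  {G G₁ G₂ : ModuleSubsheaf (n := n) F E} {V : Opens M}

namespace ModuleSubsheaf

theorem congr_mem {s t : Π x, E x} (hs : s ∈ G.sec V) (h : ∀ x ∈ V, t x = s x) : t ∈ G.sec V :=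
  G.mem_of_locally fun _ hx => ⟨V, le_rfl, hx, s, hs, h⟩

theorem sum_smul_mem {ι : Type*} (I : Finset ι) {c : ι → M → ℂ} {g : ι → Π x, E x}
    (hc : ∀ i ∈ I, IsHolFun (n := n) V (c i)) (hg : ∀ i ∈ I, g i ∈ G.sec V) :
    (fun x => ∑ i ∈ I, c i x • g i x) ∈ G.sec V := by
  classical
  induction I using Finset.induction_on with
  | empty => exact G.congr_mem (G.zero_mem V) fun x _ => by simp
  | insert a I ha ih =>
    rw [Finset.forall_mem_insert] at hc hg
    exact G.congr_mem (G.add_mem (G.smul_mem hc.1 hg.1) (ih hc.2 hg.2)) fun x _ =>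
      Finset.sum_insert ha

theorem sub_mem {s t : Π x, E x} (hs : s ∈ G.sec V) (ht : t ∈ G.sec V) :
    (fun x => s x - t x) ∈ G.sec V :=
  G.congr_mem (G.add_mem hs (G.smul_mem (f := fun _ => -1) contMDiffOn_const ht)) fun x _ => by
    simp [sub_eq_add_neg]

/-- The subsheaves `G₁` and `G₂` have zero intersection. -/
def IsDisjoint (G₁ G₂ : ModuleSubsheaf (n := n) F E) : Prop :=
  ∀ V, ∀ s ∈ G₁.sec V ∩ G₂.sec V, ∀ x ∈ V, s x = 0

theorem IsDisjoint.symm (h : G₁.IsDisjoint G₂) : G₂.IsDisjoint G₁ :=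
  fun V s hs => h V s hs.symm

theorem IsDisjoint.eq_of_add_eq_add (h : G₁.IsDisjoint G₂) {s₁ t₁ s₂ t₂ : Π x, E x}
    (hs₁ : s₁ ∈ G₁.sec V) (ht₁ : t₁ ∈ G₁.sec V) (hs₂ : s₂ ∈ G₂.sec V) (ht₂ : t₂ ∈ G₂.sec V)
    (heq : ∀ x ∈ V, s₁ x + s₂ x = t₁ x + t₂ x) : ∀ x ∈ V, s₁ x = t₁ x ∧ s₂ x = t₂ x := by
  have hdiff : ∀ x ∈ V, s₁ x - t₁ x = t₂ x - s₂ x := fun x hx => by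
    rw [sub_eq_sub_iff_add_eq_add, heq x hx, add_comm]
  intro x hx
  have h₁ : s₁ x = t₁ x := sub_eq_zero.1 <|
    h V _ ⟨sub_mem hs₁ ht₁, congr_mem (sub_mem ht₂ hs₂) hdiff⟩ x hx
  exact ⟨h₁, add_left_cancel (h₁ ▸ heq x hx)⟩

theorem IsDirectSum.isDisjoint (h : G₁.IsDirectSum G₂) : G₁.IsDisjoint G₂ :=
  fun V => (h V).2

theorem IsDisjoint.isDirectSum_of_locally (h : G₁.IsDisjoint G₂)
    (hloc : ∀ V s, IsHolSection (n := n) F E V s → ∀ x ∈ V, ∃ V' ≤ V, x ∈ V' ∧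
      ∃ s₁ ∈ G₁.sec V', ∃ s₂ ∈ G₂.sec V', ∀ y ∈ V', s y = s₁ y + s₂ y) :
    G₁.IsDirectSum G₂ := by
  refine fun V => ⟨fun s hs => ?_, h V⟩
  choose! T hTV hxT s₁ hs₁ s₂ hs₂ hsum using hloc V s hs
  have huniq : ∀ x ∈ V, ∀ y ∈ V, ∀ z ∈ T x ⊓ T y, s₁ x z = s₁ y z ∧ s₂ x z = s₂ y z :=
    fun x hx y hy => h.eq_of_add_eq_add (G₁.restrict inf_le_left (hs₁ x hx))
      (G₁.restrict inf_le_right (hs₁ y hy)) (G₂.restrict inf_le_left (hs₂ x hx))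
      (G₂.restrict inf_le_right (hs₂ y hy))
      fun z hz => (hsum x hx z hz.1).symm.trans (hsum y hy z hz.2)
  have hself : ∀ y ∈ V, ∀ x ∈ T y, s₁ x x = s₁ y x ∧ s₂ x x = s₂ y x := fun y hy x hx =>
    huniq x (hTV y hy hx) y hy x ⟨hxT x (hTV y hy hx), hx⟩
  exact ⟨fun x => s₁ x x, G₁.mem_of_locally fun y hy =>
      ⟨T y, hTV y hy, hxT y hy, s₁ y, hs₁ y hy, fun x hx => (hself y hy x hx).1⟩,
    fun x => s₂ x x, G₂.mem_of_locally fun y hy =>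
      ⟨T y, hTV y hy, hxT y hy, s₂ y, hs₂ y hy, fun x hx => (hself y hy x hx).2⟩,
    fun x hx => hsum x hx x (hxT x hx)⟩

/-- The values over `V` of the sections of `G` lie in the span of the values of the family `g`.
This is weaker than `g` generating the sheaf, which asks for holomorphic coefficients. -/
def IsPointwiseSpanned (G : ModuleSubsheaf (n := n) F E) (V : Opens M) {ι : Type*}
    (g : ι → Π x, E x) : Prop :=
  ∀ V' ≤ V, ∀ s ∈ G.sec V', ∀ x ∈ V', s x ∈ Submodule.span ℂ (Set.range fun i => g i x)

theorem IsPointwiseSpanned.mono {ι : Type*} {g : ι → Π x, E x} (h : G.IsPointwiseSpanned V g)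
    {V' : Opens M} (hV' : V' ≤ V) : G.IsPointwiseSpanned V' g :=
  fun T hT => h T (hT.trans hV')

theorem IsFiniteType.exists_isPointwiseSpanned (h : G.IsFiniteType) (x : M) :
    ∃ V : Opens M, x ∈ V ∧ ∃ (k : ℕ) (g : Fin k → Π x, E x), (∀ i, g i ∈ G.sec V) ∧
      G.IsPointwiseSpanned V g := by
  obtain ⟨V, hx, k, g, hg, hgen⟩ := h x
  refine ⟨V, hx, k, g, hg, fun V' hV' s hs y hy => ?_⟩
  obtain ⟨_, -, hy', f, -, hf⟩ := hgen V' hV' s hs y hy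
  rw [hf y hy']
  exact Submodule.sum_smul_mem _ _ fun i _ => Submodule.subset_span ⟨i, rfl⟩

end ModuleSubsheaf

end Subsheaf

section PolarFibre

variable {n : ℕ} {N : Type*} [TopologicalSpace N] [ChartedSpace (ℂ^n) N]
  [IsManifold (modelC n) ω N]

/-- The tangent vectors at `y` killed by the germs at `y` of forms vanishing on `W`. They contain
the values at `y` of the sections of `W`, with equality where `W` is a subbundle. -/
def polarFibre (W : TangentSubsheaf n N) (y : N) : Submodule ℂ (TanC n N y) where
  carrier := {u | ∀ O : Opens N, y ∈ O → ∀ θ ∈ (formsVanishingOn W).sec O, θ y u = 0}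
  zero_mem' O _ θ _ := map_zero (θ y)
  add_mem' {u v} hu hv O hO θ hθ :=
    (map_add (θ y) u v).trans <| by rw [hu O hO θ hθ, hv O hO θ hθ]; exact add_zero _
  smul_mem' c u hu O hO θ hθ :=
    (map_smul (θ y) c u).trans <| by rw [hu O hO θ hθ]; exact smul_zero _

end PolarFibre

section LiftedFields

open Filter Topology

variable {n : ℕ} {M : Type*} [TopologicalSpace M] [ChartedSpace (ℂ^n) M]
  [IsManifold (modelC n) ω M] {N : Type*} [TopologicalSpace N] [ChartedSpace (ℂ^n) N]
  [IsManifold (modelC n) ω N] {η : M → N}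

theorem isInvertible_jacobian {x₀ x : M} {y₀ : N} (hx : x ∈ chartDomain n x₀)
    (hy : η x ∈ chartDomain n y₀)
    (hinj : Function.Injective (mfderiv (modelC n) (modelC n) η x)) :
    (jacobian (m := n) (n := n) η x₀ y₀ x).IsInvertible :=
  ⟨(LinearEquiv.ofInjectiveEndo (jacobian (m := n) (n := n) η x₀ y₀ x).toLinearMap
    ((injective_jacobian_iff hx hy).2 hinj)).toContinuousLinearEquiv, rfl⟩

variable (hη : ContMDiff (modelC n) (modelC n) ω η)
include hη

theorem mfderiv_mem_polarFibre_of_mem_lifting {W : TangentSubsheaf n N} {V : Opens M}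
    {X : Π x, TanC n M x} (hX : X ∈ (lifting (m := n) η W).sec V) {x : M} (hx : x ∈ V) :
    mfderiv (modelC n) (modelC n) η x (X x) ∈ polarFibre W (η x) := by
  intro O hxO θ hθ
  let V' : Opens M := V ⊓ O.comap ⟨η, hη.continuous⟩
  have hV' : Set.MapsTo η V' O := fun z hz => hz.2
  have hhol := isHolForm_pullbackForm hη hθ.1 hV'
  have hpull : pullbackForm (m := n) η θ ∈
      (pullbackForms (m := n) η (formsVanishingOn W)).sec V' :=
    ⟨hhol, fun z hz => ⟨V', le_rfl, hz, O, hV', 1, fun _ _ => 1, fun _ => θ,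
      fun _ => contMDiffOn_const, fun _ => hθ, fun z _ => by simp⟩⟩
  have hsat : pullbackForm (m := n) η θ ∈
      (pullbackForms (m := n) η (formsVanishingOn W)).saturation.sec V' :=
    ⟨hhol, fun z hz => ⟨V', le_rfl, hz, fun _ => 1, contMDiffOn_const,
      fun O _ ⟨y, hy⟩ => ⟨y, hy, one_ne_zero⟩, by simpa only [one_smul] using hpull⟩⟩
  exact hX.2 V' inf_le_left _ hsat x ⟨hx, hxO⟩

theorem isHolField_of_mfderiv_eq {O : Opens N} {s : Π y, TanC n N y} (hs : IsHolField O s)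
    {V : Opens M} (hV : Set.MapsTo η V O)
    (hinj : ∀ x ∈ V, Function.Injective (mfderiv (modelC n) (modelC n) η x))
    {X : Π x, TanC n M x} (hX : ∀ x ∈ V, mfderiv (modelC n) (modelC n) η x (X x) = s (η x)) :
    IsHolField V X := by
  refine IsHolSection.of_locally fun x₀ hx₀ => ?_
  obtain ⟨T, hTV, hx₀T, hTO⟩ := exists_opens_le_chartDomain (m := n) (n := n) hη.continuous hV hx₀
  refine ⟨T, hTV.trans inf_le_left, hx₀T, _, (isHolField_iff (hTV.trans inf_le_right)).2 ?_,
    fun _ _ => rfl⟩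
  have hinvertible : ∀ x ∈ T, (jacobian (m := n) (n := n) η x₀ (η x₀) x).IsInvertible :=
    fun x hx => isInvertible_jacobian (hTV hx).2 (hTO hx).2 (hinj x (hTV hx).1)
  have hscoord := (isHolField_iff inf_le_right).1
    (hs.mono (inf_le_left (b := chartDomain n (η x₀))))
  intro x hx
  have hinverse := ((hinvertible x hx).contDiffAt_map_inverse (n := ω)).contMDiffAt.comp x
    (contMDiffAt_jacobian hη (hTV hx).2 (hTO hx).2)
  have hcomp := (hscoord.contMDiffAt ((O ⊓ chartDomain n (η x₀)).isOpen.mem_nhds (hTO hx))).comp x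
    hη.contMDiffAt
  refine ((hinverse.clm_apply hcomp).congr_of_eventuallyEq ?_).contMDiffWithinAt
  filter_upwards [T.isOpen.mem_nhds hx] with z hz
  refine ((hinvertible z hz).inverse_apply_eq.2 ?_).symm
  change toCoord (η x₀) (η z) (s (η z)) = _
  rw [jacobian_toCoord (hTV hz).2, hX z (hTV hz).1]

theorem mem_lifting_of_mfderiv_eq {W : TangentSubsheaf n N} {O : Opens N} {s : Π y, TanC n N y}
    (hs : s ∈ W.sec O) {V : Opens M} (hV : Set.MapsTo η V O)
    (hinj : ∀ x ∈ V, Function.Injective (mfderiv (modelC n) (modelC n) η x))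
    {X : Π x, TanC n M x} (hX : ∀ x ∈ V, mfderiv (modelC n) (modelC n) η x (X x) = s (η x)) :
    X ∈ (lifting (m := n) η W).sec V := by
  have hXhol := isHolField_of_mfderiv_eq hη (W.isHol hs) hV hinj hX
  refine ⟨hXhol, fun V' hV' θ hθ x hx => ?_⟩
  obtain ⟨A, hA, hxA, f, -, hf0, hfθ⟩ := hθ.2 x hx
  have hmul : ∀ z ∈ A, f z * θ z (X z) = 0 := by
    intro z hz
    obtain ⟨B, -, hzB, P, hP, k, c, ξ, -, hξ, hsum⟩ := hfθ.2 z hz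
    have hpull : ∀ i, pullbackForm (m := n) η (ξ i) z (X z) = 0 := fun i =>
      (congrArg (ξ i (η z)) (hX z (hV' (hA hz)))).trans <|
        (hξ i).2 (P ⊓ O) inf_le_left s (W.restrict inf_le_right hs) (η z)
          ⟨hP hzB, hV (hV' (hA hz))⟩
    calc f z * θ z (X z) = ∑ i, c i z • pullbackForm (m := n) η (ξ i) z (X z) := by
          simpa [sum_apply] using congrArg (fun L : CotC n M z => L (X z)) (hsum z hzB)
      _ = 0 := Finset.sum_eq_zero fun i _ => by rw [hpull i]; exact smul_zero _
  have hcont : ContinuousOn (fun z => θ z (X z)) A :=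
    ((hθ.1.mono hA).isHolFun_apply (hXhol.mono (hA.trans hV'))).continuousOn
  by_contra hne
  have hopen : IsOpen ((A : Set M) ∩ (fun z => θ z (X z)) ⁻¹' {0}ᶜ) :=
    hcont.isOpen_inter_preimage A.isOpen isOpen_compl_singleton
  obtain ⟨z, hz, hfz⟩ := hf0 ⟨_, hopen⟩ (fun z hz => hz.1) ⟨x, hxA, hne⟩
  exact mul_ne_zero hfz hz.2 (hmul z hz.1)

theorem eventually_bijective_mfderiv {x₀ : M}
    (h : Function.Surjective (mfderiv (modelC n) (modelC n) η x₀)) :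
    ∀ᶠ x in 𝓝 x₀, Function.Bijective (mfderiv (modelC n) (modelC n) η x) := by
  have hx₀ := mem_chartDomain_self (n := n) x₀
  have hy₀ := mem_chartDomain_self (n := n) (η x₀)
  have hsurj := (surjective_jacobian_iff hx₀ hy₀).2 h
  have hdet := (bijective_iff_det_ne_zero _).1
    ⟨(LinearMap.injective_iff_surjective (f := (jacobian (m := n) (n := n) η x₀ (η x₀)
      x₀).toLinearMap)).2 hsurj, hsurj⟩
  have hcont : ContinuousAt (fun x => (jacobian (m := n) (n := n) η x₀ (η x₀) x).det) x₀ :=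
    ContinuousLinearMap.continuous_det.continuousAt.comp
      (contMDiffAt_jacobian hη hx₀ hy₀).continuousAt
  filter_upwards [hcont.eventually_ne hdet, (chartDomain n x₀).isOpen.mem_nhds hx₀,
    hη.continuous.continuousAt.eventually_mem ((chartDomain n (η x₀)).isOpen.mem_nhds hy₀)]
    with x hdetx hx hy
  have hbij := (bijective_iff_det_ne_zero _).2 hdetx
  exact ⟨(injective_jacobian_iff hx hy).1 hbij.1, (surjective_jacobian_iff hx hy).1 hbij.2⟩

theorem isDisjoint_of_lifting (hproper : IsProperMap η) (hsurj : Function.Surjective η)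
    {W₁ W₂ : TangentSubsheaf n N}
    (h : (lifting (m := n) η W₁).IsDisjoint (lifting (m := n) η W₂)) : W₁.IsDisjoint W₂ := by
  rintro V s ⟨h₁, h₂⟩ y hy
  by_contra hne
  have hopen := isOpen_inter_setOf_toCoord_ne_zero (inf_le_right (a := V) (b := chartDomain n y))
    ((W₁.isHol h₁).mono inf_le_left)
  have hy' : toCoord y y (s y) ≠ 0 :=
    (map_ne_zero_iff _ (toCoord_bijective (mem_chartDomain_self y)).injective).2 hne
  obtain ⟨x, hx, hxs⟩ := exists_surjective_mfderiv le_rfl hη hproper hsurj (O := ⟨_, hopen⟩)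
    ⟨y, ⟨hy, mem_chartDomain_self y⟩, hy'⟩
  obtain ⟨T, hT, hTo, hxT⟩ := eventually_nhds_iff.1 ((eventually_bijective_mfderiv hη hxs).and
    (hη.continuous.continuousAt.eventually_mem (hopen.mem_nhds hx)))
  choose! X hX using fun z (hz : z ∈ T) => (hT z hz).1.2 (s (η z))
  have hmem : ∀ {W : TangentSubsheaf n N}, s ∈ W.sec V →
      X ∈ (lifting (m := n) η W).sec ⟨T, hTo⟩ := fun hs =>
    mem_lifting_of_mfderiv_eq hη hs (fun z hz => (hT z hz).2.1.1) (fun z hz => (hT z hz).1.1) hX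
  have hXx : X x = 0 := h ⟨T, hTo⟩ X ⟨hmem h₁, hmem h₂⟩ x hxT
  refine hx.2 ?_
  rw [← hX x hxT, hXx, map_zero, map_zero]

end LiftedFields

section PolarFibreSpan

open Filter Topology

theorem exists_contDiff_clm_apply_eq {𝕜 : Type*} [NontriviallyNormedField 𝕜]
    [CompleteSpace 𝕜] {E : Type*} [NormedAddCommGroup E] [NormedSpace 𝕜 E]
    [FiniteDimensional 𝕜 E] {ι : Type*} [Fintype ι] {v : ι → E} (hv : LinearIndependent 𝕜 v)
    (k : WithTop ℕ∞) :
    ∃ A : (ι → E) → E →L[𝕜] E, ContDiff 𝕜 k A ∧ A v = ContinuousLinearMap.id 𝕜 E ∧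
      ∀ w i, A w (v i) = w i := by
  classical
  obtain ⟨L, hL⟩ := LinearMap.exists_leftInverse_of_injective (Fintype.linearCombination 𝕜 v)
    (LinearMap.ker_eq_bot.2 (linearIndependent_iff_injective_fintypeLinearCombination.1 hv))
  have hLv : ∀ j, L (v j) = Pi.single j 1 := fun j => by
    simpa using LinearMap.congr_fun hL (Pi.single j 1)
  let ℓ : ι → E →L[𝕜] 𝕜 := fun i => (LinearMap.proj i ∘ₗ L).toContinuousLinearMap
  refine ⟨fun w => .id 𝕜 E + ∑ i, (ℓ i).smulRight (w i - v i), ?_, ?_, fun w j => ?_⟩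
  · exact contDiff_const.add <| ContDiff.sum fun i _ =>
      (ContinuousLinearMap.smulRightL 𝕜 E E (ℓ i)).contDiff.comp
        ((contDiff_apply 𝕜 E i).sub contDiff_const)
  · simp
  · simp [ℓ, hLv, Pi.single_apply, sum_apply]

variable {n : ℕ} {N : Type*} [TopologicalSpace N] [ChartedSpace (ℂ^n) N]
  [IsManifold (modelC n) ω N]

theorem exists_isHolForm_of_linearIndependent {V : Opens N} {y₀ : N} (hy₀ : y₀ ∈ V) {ι : Type*}
    [Finite ι] {g : ι → Π y, TanC n N y} (hg : ∀ i, IsHolField V (g i))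
    (hli : LinearIndependent ℂ fun i => g i y₀) (φ : TanC n N y₀ →ₗ[ℂ] ℂ)
    (hφ : ∀ i, φ (g i y₀) = 0) :
    ∃ V' ≤ V, y₀ ∈ V' ∧ ∃ θ : Π y, CotC n N y, IsHolForm V' θ ∧ (∀ u, θ y₀ u = φ u) ∧
      ∀ y ∈ V', ∀ i, θ y (g i y) = 0 := by
  have := Fintype.ofFinite ι
  let V₁ : Opens N := V ⊓ chartDomain n y₀
  have hy₀' := mem_chartDomain_self (n := n) y₀
  let G : N → ι → ℂ^n := fun y i => toCoord y₀ y (g i y)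
  have hG : ContMDiffOn (modelC n) (modelWithCornersSelf ℂ (ι → ℂ^n)) ω G V₁ :=
    contMDiffOn_pi_space.2 fun i => (isHolField_iff inf_le_right).1 ((hg i).mono inf_le_left)
  have hGli : LinearIndependent ℂ (G y₀) := hli.map' (toCoord y₀ y₀).toLinearMap
    (LinearMap.ker_eq_bot.2 (toCoord_bijective hy₀').injective)
  -- `A (G y)` carries the coordinates of the frame at `y₀` to those at `y`
  obtain ⟨A, hA, hA₀, hAG⟩ := exists_contDiff_clm_apply_eq hGli ω
  have hAhol := hA.contMDiff.comp_contMDiffOn hG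
  let V₂ : Opens N := ⟨V₁ ∩ (A ∘ G) ⁻¹' {L | L.IsInvertible},
    hAhol.continuousOn.isOpen_inter_preimage V₁.isOpen ContinuousLinearEquiv.isOpen⟩
  have hinvertible : ∀ y ∈ V₂, (A (G y)).IsInvertible := fun _ hy => hy.2
  let ψ : ℂ^n →L[ℂ] ℂ :=
    LinearMap.toContinuousLinearMap (φ ∘ₗ (ofCoord y₀ y₀).toLinearMap)
  have hψ : ∀ u, ψ (toCoord y₀ y₀ u) = φ u := fun u => congrArg φ (ofCoord_toCoord hy₀' u)
  let θ : Π y, CotC n N y := fun y => by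
    exact (ψ.comp (A (G y)).inverse).comp (toCoord y₀ y)
  refine ⟨V₂, fun y hy => hy.1.1, ⟨⟨hy₀, hy₀'⟩, ?_⟩, θ,
    (isHolForm_iff (V := V₂) (x₀ := y₀) fun y hy => hy.1.2).2 fun y hy => ?_, ?_, fun y hy i => ?_⟩
  · exact ⟨.refl ℂ _, hA₀.symm⟩
  · have hinverse := ((hinvertible y hy).contDiffAt_map_inverse (n := ω)).contMDiffAt.comp y
      (hAhol.contMDiffAt (V₁.isOpen.mem_nhds hy.1))
    refine (contMDiffAt_const.clm_comp hinverse).contMDiffWithinAt.congr_of_eventuallyEq_of_mem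
      (f := fun z => ψ.comp (A (G z)).inverse) ?_ hy
    filter_upwards [self_mem_nhdsWithin] with z hz
    ext v
    exact congrArg (fun w => ψ ((A (G z)).inverse w)) (toCoord_ofCoord hz.1.2 v)
  · intro u
    change ψ ((A (G y₀)).inverse (toCoord y₀ y₀ u)) = φ u
    rw [hA₀, ContinuousLinearMap.inverse_id]
    exact hψ u
  · change ψ ((A (G y)).inverse (G y i)) = 0
    rw [(hinvertible y hy).inverse_apply_eq.2 (hAG (G y) i).symm]
    exact (hψ (g i y₀)).trans (hφ i)

theorem polarFibre_le_span {W : TangentSubsheaf n N} {V : Opens N} {y₀ : N} (hy₀ : y₀ ∈ V)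
    {ι : Type*} [Finite ι] {g : ι → Π y, TanC n N y} (hg : ∀ i, IsHolField V (g i))
    (hli : LinearIndependent ℂ fun i => g i y₀) (hspan : W.IsPointwiseSpanned V g) :
    polarFibre W y₀ ≤ Submodule.span ℂ (Set.range fun i => g i y₀) := by
  intro u hu
  by_contra hnot
  obtain ⟨φ, hφu, hφ⟩ := Submodule.exists_le_ker_of_notMem hnot
  obtain ⟨V', hV', hy₀', θ, hθ, hθφ, hθg⟩ := exists_isHolForm_of_linearIndependent hy₀ hg hli
    φ fun i => hφ (Submodule.subset_span ⟨i, rfl⟩)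
  have hker : ∀ y ∈ V', Submodule.span ℂ (Set.range fun i => g i y) ≤
      LinearMap.ker (θ y).toLinearMap := fun y hy =>
    Submodule.span_le.2 <| Set.range_subset_iff.2 fun i => hθg y hy i
  refine hφu ?_
  have h0 := hu V' hy₀' θ ⟨hθ, fun V'' hV'' X hX y hy =>
    hker y (hV'' hy) (hspan V'' (hV''.trans hV') X hX y hy)⟩
  rwa [hθφ] at h0

end PolarFibreSpan

section LiftedProjection

variable {n : ℕ} {M : Type*} [TopologicalSpace M] [ChartedSpace (ℂ^n) M]
  [IsManifold (modelC n) ω M]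

theorem isHolField_ofCoord (x₀ : M) (v : ℂ^n) :
    IsHolField (chartDomain n x₀) fun x => ofCoord x₀ x v :=
  (isHolField_iff le_rfl).2 <| contMDiffOn_const.congr fun _ hx => toCoord_ofCoord hx v

theorem ModuleSubsheaf.IsDirectSum.exists_continuousOn_projection {G₁ G₂ : TangentSubsheaf n M}
    (h : G₁.IsDirectSum G₂) (x₀ : M) :
    ∃ p : M → ℂ^n →L[ℂ] ℂ^n, ContinuousOn p (chartDomain n x₀) ∧ ∀ v,
      (fun x => ofCoord x₀ x (p x v)) ∈ G₁.sec (chartDomain n x₀) ∧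
      (fun x => ofCoord x₀ x (v - p x v)) ∈ G₂.sec (chartDomain n x₀) := by
  let b := EuclideanSpace.basisFun (Fin n) ℂ
  choose X hX Y hY hXY using fun i => (h _).1 _ (isHolField_ofCoord x₀ (b i))
  let p : M → ℂ^n →L[ℂ] ℂ^n := fun x =>
    ∑ i, (EuclideanSpace.proj i : ℂ^n →L[ℂ] ℂ).smulRight (toCoord x₀ x (X i x))
  have hpX : ∀ x ∈ chartDomain n x₀, ∀ v, ofCoord x₀ x (p x v) = ∑ i, v i • X i x := by
    intro x hx v
    simp [p, sum_apply, ofCoord_toCoord hx]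
  have hpY : ∀ x ∈ chartDomain n x₀, ∀ v, ofCoord x₀ x (v - p x v) = ∑ i, v i • Y i x := by
    intro x hx v
    have hv : v = ∑ i, v i • b i := by simpa [b] using (b.sum_repr v).symm
    have hofv : ofCoord x₀ x v = ∑ i, v i • (X i x + Y i x) := by
      conv_lhs => rw [hv]
      simp only [map_sum, map_smul, hXY _ x hx]
    rw [map_sub, hofv, hpX x hx, sub_eq_iff_eq_add', ← Finset.sum_add_distrib]
    exact Finset.sum_congr rfl fun i _ => smul_add ..
  refine ⟨p, continuousOn_finsetSum _ fun i _ => ?_, fun v => ⟨?_, ?_⟩⟩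
  · exact (ContinuousLinearMap.smulRightL ℂ (ℂ^n) (ℂ^n)
      (EuclideanSpace.proj i)).continuous.comp_continuousOn
        ((isHolField_iff le_rfl).1 (G₁.isHol (hX i))).continuousOn
  · exact ModuleSubsheaf.congr_mem (ModuleSubsheaf.sum_smul_mem _
      (fun i _ => contMDiffOn_const) fun i _ => hX i)
      fun x hx => hpX x hx v
  · exact ModuleSubsheaf.congr_mem (ModuleSubsheaf.sum_smul_mem _
      (fun i _ => contMDiffOn_const) fun i _ => hY i)
      fun x hx => hpY x hx v

end LiftedProjection

section IdentityTheorem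

open Filter Topology

variable {n : ℕ} {M : Type*} [TopologicalSpace M] [ChartedSpace (ℂ^n) M]
  [IsManifold (modelC n) ω M]

theorem exists_opens_forall_nowhereLocallyZero {O : Opens M} {x₀ : M} (hx₀ : x₀ ∈ O) :
    ∃ V ≤ O ⊓ chartDomain n x₀, x₀ ∈ V ∧
      ∀ f : M → ℂ, IsHolFun (n := n) V f → (∃ x ∈ V, f x ≠ 0) → NowhereLocallyZero V f := by
  let ψ := extChartAt (modelC n) x₀
  have hnhds : ψ.target ∩ ψ.symm ⁻¹' O ∈ 𝓝 (ψ x₀) :=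
    inter_mem (extChartAt_target_mem_nhds x₀)
      (tendsto_extChartAt_symm x₀ (O.isOpen.mem_nhds hx₀))
  obtain ⟨r, hr, hball⟩ := Metric.mem_nhds_iff.1 hnhds
  have hsource : ψ.source = chartDomain n x₀ := extChartAt_source (modelC n) x₀
  let V : Opens M := ⟨ψ.source ∩ ψ ⁻¹' Metric.ball (ψ x₀) r,
    (continuousOn_extChartAt x₀).isOpen_inter_preimage (isOpen_extChartAt_source x₀)
      Metric.isOpen_ball⟩
  refine ⟨V, fun x hx => ⟨?_, hsource.subset hx.1⟩, ⟨mem_extChartAt_source x₀,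
    Metric.mem_ball_self hr⟩, fun f hf ⟨x₁, hx₁, hne⟩ T hT ⟨x₂, hx₂⟩ => ?_⟩
  · have h := (hball hx.2).2
    rwa [Set.mem_preimage, ψ.left_inv hx.1] at h
  by_contra! h0
  have hleft : ∀ {x}, x ∈ V → ψ.symm (ψ x) = x := fun hx => ψ.left_inv hx.1
  have hanalytic : AnalyticOnNhd ℂ (f ∘ ψ.symm) (Metric.ball (ψ x₀) r) := by
    intro z hz
    have hzV : ψ.symm z ∈ V := ⟨ψ.map_target (hball hz).1, by
      rwa [Set.mem_preimage, ψ.right_inv (hball hz).1]⟩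
    rw [← ψ.right_inv (hball hz).1]
    exact analyticAt_comp_extChartAt_symm (hsource.subset hzV.1)
      (hf.contMDiffAt (V.isOpen.mem_nhds hzV))
  have hzero : f ∘ ψ.symm =ᶠ[𝓝 (ψ x₂)] 0 := by
    have hcont : ContinuousAt ψ.symm (ψ x₂) :=
      continuousAt_extChartAt_symm'' (hball (hT hx₂).2).1
    filter_upwards [hcont.eventually_mem (T.isOpen.mem_nhds (x := ψ.symm (ψ x₂))
      ((hleft (hT hx₂)).symm ▸ hx₂))] with z hz using h0 _ hz
  have := hanalytic.eqOn_zero_of_preconnected_of_eventuallyEq_zero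
    (convex_ball _ _).isPreconnected (hT hx₂).2 hzero hx₁.2
  rw [Function.comp_apply, hleft hx₁] at this
  exact hne this

end IdentityTheorem

section FrameMap

variable {n : ℕ} {N : Type*} [TopologicalSpace N] [ChartedSpace (ℂ^n) N]
  [IsManifold (modelC n) ω N]

/-- The linear map taking the standard basis to the vectors `g j y` in the chart around `y₀`. Its
determinant vanishes exactly where the `g j` fail to be a frame. -/
noncomputable def frameMap (y₀ : N) (g : Fin n → Π y, TanC n N y) (y : N) : ℂ^n →L[ℂ] ℂ^n :=
  ∑ j, (EuclideanSpace.proj j : ℂ^n →L[ℂ] ℂ).smulRight (toCoord y₀ y (g j y))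

theorem frameMap_apply (y₀ : N) (g : Fin n → Π y, TanC n N y) (y : N) (v : ℂ^n) :
    frameMap y₀ g y v = ∑ j, v j • toCoord y₀ y (g j y) := by
  simp [frameMap, sum_apply]

theorem linearIndependent_iff_det_frameMap_ne_zero {y₀ y : N} {g : Fin n → Π y, TanC n N y} :
    LinearIndependent ℂ (fun i => toCoord y₀ y (g i y)) ↔ (frameMap y₀ g y).det ≠ 0 := by
  have hcomp : ⇑(frameMap y₀ g y) =
      Fintype.linearCombination ℂ (fun i => toCoord y₀ y (g i y)) ∘
        WithLp.linearEquiv 2 ℂ (Fin n → ℂ) := by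
    ext1 v
    rw [frameMap_apply]
    simp [Fintype.linearCombination_apply]
  rw [← bijective_iff_det_ne_zero, linearIndependent_iff_injective_fintypeLinearCombination,
    ← Function.Injective.of_comp_iff' _ (WithLp.linearEquiv 2 ℂ (Fin n → ℂ)).bijective, ← hcomp]
  exact ⟨fun h => ⟨h, LinearMap.surjective_of_injective (f := (frameMap y₀ g y).toLinearMap) h⟩,
    fun h => h.1⟩

theorem sum_adjugate_frameMap_smul {y₀ y : N} (hy : y ∈ chartDomain n y₀)
    (g : Fin n → Π y, TanC n N y) (u : TanC n N y) :
    ∑ j, adjugate (frameMap y₀ g y) (toCoord y₀ y u) j • g j y = (frameMap y₀ g y).det • u := by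
  refine (toCoord_bijective hy).injective ?_
  rw [map_sum, map_smul, ← self_apply_adjugate, frameMap_apply]
  simp only [map_smul]

section Holomorphic

variable {y₀ : N} {V : Opens N} (hV : V ≤ chartDomain n y₀) {g : Fin n → Π y, TanC n N y}
  (hg : ∀ i, IsHolField V (g i))
include hV hg

theorem contMDiffOn_frameMap : ContMDiffOn (modelC n)
    (modelWithCornersSelf ℂ (ℂ^n →L[ℂ] ℂ^n)) ω (frameMap y₀ g) V :=
  contMDiffOn_finsetSum fun i _ =>
    (ContinuousLinearMap.smulRightL ℂ (ℂ^n) (ℂ^n)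
      (EuclideanSpace.proj i)).contMDiff.comp_contMDiffOn ((isHolField_iff hV).1 (hg i))

theorem isHolFun_det_frameMap : IsHolFun (n := n) V fun y => (frameMap y₀ g y).det :=
  contDiff_det.contMDiff.comp_contMDiffOn (contMDiffOn_frameMap hV hg)

theorem isHolFun_adjugate_frameMap {s : Π y, TanC n N y} (hs : IsHolField V s) (j : Fin n) :
    IsHolFun (n := n) V fun y => adjugate (frameMap y₀ g y) (toCoord y₀ y (s y)) j :=
  (EuclideanSpace.proj j : ℂ^n →L[ℂ] ℂ).contMDiff.comp_contMDiffOn <|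
    (contDiff_adjugate.contMDiff.comp_contMDiffOn (contMDiffOn_frameMap hV hg)).clm_apply
      ((isHolField_iff hV).1 hs)

end Holomorphic

end FrameMap

section AdaptedFrame

variable {n : ℕ} {N : Type*} [TopologicalSpace N] [ChartedSpace (ℂ^n) N]
  [IsManifold (modelC n) ω N] {W₁ W₂ : TangentSubsheaf n N} {y₀ : N} {V : Opens N}
  {I : Finset (Fin n)} {g : Fin n → Π y, TanC n N y}

/-- A family of `n` fields over `V`, those in `I` from `W₁` and the others from `W₂`, which is a
frame of the tangent bundle at the generic point of `V`. -/
structure IsAdaptedFrame (W₁ W₂ : TangentSubsheaf n N) (y₀ : N) (V : Opens N) (I : Finset (Fin n))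
    (g : Fin n → Π y, TanC n N y) : Prop where
  le_chartDomain : V ≤ chartDomain n y₀
  mem_left : ∀ i ∈ I, g i ∈ W₁.sec V
  mem_right : ∀ i ∉ I, g i ∈ W₂.sec V
  nowhereLocallyZero_det : NowhereLocallyZero V fun y => (frameMap y₀ g y).det

/-- The part in the fields `g i`, `i ∈ I`, of the expansion of `δ s` by Cramer's rule, where `δ` is
the determinant of the frame. -/
noncomputable def cramerPart (y₀ : N) (g : Fin n → Π y, TanC n N y) (I : Finset (Fin n))
    (s : Π y, TanC n N y) (y : N) : TanC n N y :=
  ∑ i ∈ I, adjugate (frameMap y₀ g y) (toCoord y₀ y (s y)) i • g i y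

theorem cramerPart_mem_span (y₀ : N) (g : Fin n → Π y, TanC n N y) (I : Finset (Fin n))
    (s : Π y, TanC n N y) (y : N) :
    cramerPart y₀ g I s y ∈ Submodule.span ℂ (Set.range fun i : I => g i y) :=
  Submodule.sum_smul_mem _ _ fun i hi => Submodule.subset_span ⟨⟨i, hi⟩, rfl⟩

theorem cramerPart_add_cramerPart_compl {y : N} (hy : y ∈ chartDomain n y₀)
    (s : Π y, TanC n N y) :
    cramerPart y₀ g I s y + cramerPart y₀ g Iᶜ s y = (frameMap y₀ g y).det • s y :=
  (Finset.sum_add_sum_compl I _).trans (sum_adjugate_frameMap_smul hy g (s y))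

namespace IsAdaptedFrame

variable (h : IsAdaptedFrame W₁ W₂ y₀ V I g)
include h

theorem symm : IsAdaptedFrame W₂ W₁ y₀ V Iᶜ g where
  le_chartDomain := h.le_chartDomain
  mem_left i hi := h.mem_right i (Finset.mem_compl.1 hi)
  mem_right i hi := h.mem_left i (by simpa using hi)
  nowhereLocallyZero_det := h.nowhereLocallyZero_det

theorem isHolField (i : Fin n) : IsHolField V (g i) := by
  by_cases hi : i ∈ I
  exacts [W₁.isHol (h.mem_left i hi), W₂.isHol (h.mem_right i hi)]

theorem isHolFun_det : IsHolFun (n := n) V fun y => (frameMap y₀ g y).det :=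
  isHolFun_det_frameMap h.le_chartDomain h.isHolField

theorem mono {V' : Opens N} (hV' : V' ≤ V) : IsAdaptedFrame W₁ W₂ y₀ V' I g where
  le_chartDomain := hV'.trans h.le_chartDomain
  mem_left i hi := W₁.restrict hV' (h.mem_left i hi)
  mem_right i hi := W₂.restrict hV' (h.mem_right i hi)
  nowhereLocallyZero_det := h.nowhereLocallyZero_det.mono hV'

theorem cramerPart_mem {s : Π y, TanC n N y} (hs : IsHolField V s) :
    cramerPart y₀ g I s ∈ W₁.sec V :=
  ModuleSubsheaf.sum_smul_mem I
    (fun i _ => isHolFun_adjugate_frameMap h.le_chartDomain h.isHolField hs i) h.mem_left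

theorem cramerPart_eq_of_mem (hdisj : W₁.IsDisjoint W₂) {s : Π y, TanC n N y}
    (hs : s ∈ W₁.sec V) {y : N} (hy : y ∈ V) :
    cramerPart y₀ g I s y = (frameMap y₀ g y).det • s y := by
  have hadd : ∀ y ∈ V, cramerPart y₀ g I s y + cramerPart y₀ g Iᶜ s y =
      (frameMap y₀ g y).det • s y + 0 := fun y hy => by
    rw [add_zero, cramerPart_add_cramerPart_compl (h.le_chartDomain hy)]
  exact (hdisj.eq_of_add_eq_add (h.cramerPart_mem (W₁.isHol hs))
    (W₁.smul_mem h.isHolFun_det hs) (h.symm.cramerPart_mem (W₁.isHol hs)) (W₂.zero_mem V)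
    hadd y hy).1

theorem polarFibre_le_span (hdisj : W₁.IsDisjoint W₂) {y : N} (hy : y ∈ V)
    (hdet : (frameMap y₀ g y).det ≠ 0) :
    polarFibre W₁ y ≤ Submodule.span ℂ (Set.range fun i : I => g i y) := by
  let V' : Opens N := ⟨(V : Set N) ∩ (fun y => (frameMap y₀ g y).det) ⁻¹' {0}ᶜ,
    (ContMDiffOn.continuousOn h.isHolFun_det).isOpen_inter_preimage V.isOpen
      isOpen_compl_singleton⟩
  have hV' : V' ≤ V := fun z hz => hz.1
  have hli : LinearIndependent ℂ fun i => g i y :=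
    .of_comp (toCoord y₀ y).toLinearMap (linearIndependent_iff_det_frameMap_ne_zero.2 hdet)
  refine _root_.polarFibre_le_span (V := V') ⟨hy, hdet⟩ (g := fun i : I => g i)
    (fun i => (h.isHolField i).mono hV') (hli.comp _ Subtype.val_injective) ?_
  intro T hT s hs z hz
  rw [← Submodule.smul_mem_iff _ (hT hz).2,
    ← (h.mono (hT.trans hV')).cramerPart_eq_of_mem hdisj hs hz]
  exact cramerPart_mem_span y₀ g I s z

end IsAdaptedFrame

end AdaptedFrame

section AdaptedFrameExistence

variable {n : ℕ} {N : Type*} [TopologicalSpace N] [ChartedSpace (ℂ^n) N]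
  [IsManifold (modelC n) ω N]

theorem exists_opens_polarFibre_le_span {W : TangentSubsheaf n N} {y₀ : N} {V : Opens N}
    (hne : (V : Set N).Nonempty) (hV : V ≤ chartDomain n y₀) {ι : Type*} [Finite ι]
    {g : ι → Π y, TanC n N y} (hg : ∀ i, IsHolField V (g i)) (hspan : W.IsPointwiseSpanned V g) :
    ∃ O ≤ V, (O : Set N).Nonempty ∧
      ∀ y ∈ O, polarFibre W y ≤ Submodule.span ℂ (Set.range fun i => g i y) := by
  obtain ⟨O, hOV, hO, hOne, I, hI⟩ := exists_isOpen_linearIndepOn_span (𝕜 := ℂ) V.isOpen hne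
    (v := fun i y => toCoord y₀ y (g i y)) fun i => ((isHolField_iff hV).1 (hg i)).continuousOn
  refine ⟨⟨O, hO⟩, hOV, hOne, fun y hy => ?_⟩
  have hspanI : W.IsPointwiseSpanned ⟨O, hO⟩ fun i : I => g i := by
    intro V' hV' s hs z hz
    refine Submodule.span_le.2 (Set.range_subset_iff.2 fun j => ?_)
      (hspan V' (hV'.trans hOV) s hs z hz)
    have hj := (hI z (hV' hz)).2 j
    rw [Set.image_eq_range] at hj
    refine (Submodule.apply_mem_span_image_iff_mem_span (f := (toCoord y₀ z).toLinearMap)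
      (toCoord_bijective (hV (hOV (hV' hz)))).injective).1 ?_
    rw [← Set.range_comp]
    exact hj
  have hli : LinearIndependent ℂ fun i : I => g i y :=
    .of_comp (toCoord y₀ y).toLinearMap (hI y hy).1
  exact (polarFibre_le_span (V := ⟨O, hO⟩) hy (fun i : I => (hg i).mono hOV) hli hspanI).trans
    (Submodule.span_mono (Set.range_comp_subset_range Subtype.val fun i => g i y))

theorem exists_linearIndependent_comp_of_span_eq_top {K E ι : Type*} [DivisionRing K]
    [AddCommGroup E] [Module K E] {v : ι → E} (hv : Submodule.span K (Set.range v) = ⊤) {d : ℕ}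
    [Module.Finite K E] (hd : Module.finrank K E = d) :
    ∃ a : Fin d → ι, LinearIndependent K (v ∘ a) := by
  obtain ⟨κ, a, -, hspan, hli⟩ := exists_linearIndependent' K v
  let b := Module.Basis.mk hli (hspan.trans hv).ge
  exact ⟨a ∘ (Module.finBasisOfFinrankEq K E hd).indexEquiv b,
    hli.comp _ (Equiv.injective _)⟩

theorem exists_span_sumElim_eq_top {W₁ W₂ : TangentSubsheaf n N}
    (hsup : ∀ O : Opens N, (O : Set N).Nonempty → ∃ y ∈ O, polarFibre W₁ y ⊔ polarFibre W₂ y = ⊤)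
    {y₀ : N} {V : Opens N} (hne : (V : Set N).Nonempty) (hV : V ≤ chartDomain n y₀)
    {ι₁ ι₂ : Type*} [Finite ι₁] [Finite ι₂] {g₁ : ι₁ → Π y, TanC n N y}
    {g₂ : ι₂ → Π y, TanC n N y} (hg₁ : ∀ i, IsHolField V (g₁ i)) (hg₂ : ∀ i, IsHolField V (g₂ i))
    (hspan₁ : W₁.IsPointwiseSpanned V g₁) (hspan₂ : W₂.IsPointwiseSpanned V g₂) :
    ∃ y ∈ V, Submodule.span ℂ (Set.range fun i => toCoord y₀ y (Sum.elim g₁ g₂ i y)) = ⊤ := by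
  obtain ⟨O₁, hO₁, hO₁ne, hle₁⟩ := exists_opens_polarFibre_le_span hne hV hg₁ hspan₁
  obtain ⟨O₂, hO₂, hO₂ne, hle₂⟩ := exists_opens_polarFibre_le_span hO₁ne (hO₁.trans hV)
    (fun i => (hg₂ i).mono hO₁) (hspan₂.mono hO₁)
  obtain ⟨y, hy, hytop⟩ := hsup O₂ hO₂ne
  have hyV : y ∈ V := hO₁ (hO₂ hy)
  refine ⟨y, hyV, ?_⟩
  have hspan : Submodule.span ℂ (Set.range fun i => Sum.elim g₁ g₂ i y) = ⊤ := by
    have hrange : (Set.range fun i => Sum.elim g₁ g₂ i y) =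
        (Set.range fun i => g₁ i y) ∪ Set.range fun i => g₂ i y := by
      rw [← Set.Sum.elim_range]
      exact congrArg Set.range (funext fun i => by cases i <;> rfl)
    rw [hrange, Submodule.span_union, eq_top_iff, ← hytop]
    exact sup_le_sup (hle₁ y (hO₂ hy)) (hle₂ y hy)
  rw [show (fun i => toCoord y₀ y (Sum.elim g₁ g₂ i y)) =
      (toCoord y₀ y).toLinearMap ∘ fun i => Sum.elim g₁ g₂ i y from rfl,
    Set.range_comp, ← Submodule.map_span, hspan, Submodule.map_top]
  exact LinearMap.range_eq_top.2 (toCoord_bijective (hV hyV)).surjective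

theorem exists_isAdaptedFrame {W₁ W₂ : TangentSubsheaf n N} (hW₁ : W₁.IsFiniteType)
    (hW₂ : W₂.IsFiniteType)
    (hsup : ∀ O : Opens N, (O : Set N).Nonempty → ∃ y ∈ O, polarFibre W₁ y ⊔ polarFibre W₂ y = ⊤)
    {O : Opens N} {y₀ : N} (hy₀ : y₀ ∈ O) :
    ∃ V ≤ O, y₀ ∈ V ∧ ∃ I g, IsAdaptedFrame W₁ W₂ y₀ V I g := by
  obtain ⟨V₁, hy₁, k₁, g₁, hg₁, hspan₁⟩ := hW₁.exists_isPointwiseSpanned y₀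
  obtain ⟨V₂, hy₂, k₂, g₂, hg₂, hspan₂⟩ := hW₂.exists_isPointwiseSpanned y₀
  obtain ⟨V, hVO, hy₀V, hidentity⟩ := exists_opens_forall_nowhereLocallyZero (n := n)
    (O := O ⊓ (V₁ ⊓ V₂)) ⟨hy₀, hy₁, hy₂⟩
  obtain ⟨⟨hVO, hVV₁, hVV₂⟩, hV⟩ : (V ≤ O ∧ V ≤ V₁ ∧ V ≤ V₂) ∧ V ≤ chartDomain n y₀ := by
    simpa only [le_inf_iff] using hVO
  replace hg₁ := fun i => W₁.restrict hVV₁ (hg₁ i)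
  replace hg₂ := fun i => W₂.restrict hVV₂ (hg₂ i)
  obtain ⟨y, hyV, hspan⟩ := exists_span_sumElim_eq_top hsup ⟨y₀, hy₀V⟩ hV
    (fun i => W₁.isHol (hg₁ i)) (fun i => W₂.isHol (hg₂ i)) (hspan₁.mono hVV₁) (hspan₂.mono hVV₂)
  obtain ⟨a, ha⟩ := exists_linearIndependent_comp_of_span_eq_top hspan finrank_euclideanSpace_fin
  have hhol : ∀ i, IsHolField V (Sum.elim g₁ g₂ i) :=
    Sum.rec (fun i => W₁.isHol (hg₁ i)) fun i => W₂.isHol (hg₂ i)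
  refine ⟨V, hVO, hy₀V, Finset.univ.filter fun i => (a i).isLeft, Sum.elim g₁ g₂ ∘ a, hV,
    fun i hi => ?_, fun i hi => ?_, hidentity _ (isHolFun_det_frameMap hV fun i => hhol (a i))
      ⟨y, hyV, linearIndependent_iff_det_frameMap_ne_zero.1 ha⟩⟩
  · obtain ⟨j, hj⟩ := Sum.isLeft_iff.1 (Finset.mem_filter.1 hi).2
    change Sum.elim g₁ g₂ (a i) ∈ W₁.sec V
    rw [hj]
    exact hg₁ j
  · obtain ⟨j, hj⟩ := Sum.isRight_iff.1 (by simpa using hi)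
    change Sum.elim g₁ g₂ (a i) ∈ W₂.sec V
    rw [hj]
    exact hg₂ j

variable {M : Type*} [TopologicalSpace M] [ChartedSpace (ℂ^n) M] [IsManifold (modelC n) ω M]

theorem polarFibre_sup_polarFibre_eq_top {η : M → N} (hη : ContMDiff (modelC n) (modelC n) ω η)
    {W₁ W₂ : TangentSubsheaf n N}
    (h : (lifting (m := n) η W₁).IsDirectSum (lifting (m := n) η W₂)) {x : M}
    (hx : Function.Surjective (mfderiv (modelC n) (modelC n) η x)) :
    polarFibre W₁ (η x) ⊔ polarFibre W₂ (η x) = ⊤ := by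
  refine eq_top_iff.2 fun w _ => ?_
  obtain ⟨u, rfl⟩ := hx w
  have hxx := mem_chartDomain_self (n := n) x
  obtain ⟨X, hX, Y, hY, hXY⟩ := (h _).1 _ (isHolField_ofCoord x (toCoord x x u))
  rw [← ofCoord_toCoord hxx u, hXY x hxx, map_add]
  exact Submodule.add_mem_sup (mfderiv_mem_polarFibre_of_mem_lifting hη hX hxx)
    (mfderiv_mem_polarFibre_of_mem_lifting hη hY hxx)

end AdaptedFrameExistence

section CramerBound

open Filter Topology

variable {n : ℕ} {N : Type*} [TopologicalSpace N] [ChartedSpace (ℂ^n) N]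
  [IsManifold (modelC n) ω N] {W₁ W₂ : TangentSubsheaf n N} {y₀ : N} {V : Opens N}
  {I : Finset (Fin n)} {g : Fin n → Π y, TanC n N y}

theorem IsAdaptedFrame.cramerPart_eq_det_smul (hg : IsAdaptedFrame W₁ W₂ y₀ V I g)
    (hdisj : W₁.IsDisjoint W₂) {s : Π y, TanC n N y} {y : N} (hy : y ∈ V)
    (hdet : (frameMap y₀ g y).det ≠ 0) {u₁ u₂ : TanC n N y} (hu₁ : u₁ ∈ polarFibre W₁ y)
    (hu₂ : u₂ ∈ polarFibre W₂ y) (hs : s y = u₁ + u₂) :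
    cramerPart y₀ g I s y = (frameMap y₀ g y).det • u₁ := by
  have hli : LinearIndependent ℂ fun i => g i y :=
    .of_comp (toCoord y₀ y).toLinearMap (linearIndependent_iff_det_frameMap_ne_zero.2 hdet)
  have hspan : Disjoint (Submodule.span ℂ (Set.range fun i : I => g i y))
      (Submodule.span ℂ (Set.range fun i : (Iᶜ : Finset (Fin n)) => g i y)) := by
    have := hli.disjoint_span_image (Finset.disjoint_coe.2 (disjoint_compl_right (a := I)))
    rwa [Set.image_eq_range, Set.image_eq_range] at this
  have hsum : cramerPart y₀ g I s y - (frameMap y₀ g y).det • u₁ =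
      (frameMap y₀ g y).det • u₂ - cramerPart y₀ g Iᶜ s y := by
    rw [sub_eq_sub_iff_add_eq_add, cramerPart_add_cramerPart_compl (hg.le_chartDomain hy), hs,
      smul_add, add_comm]
  refine sub_eq_zero.1 (Submodule.disjoint_def.1 hspan _
    (sub_mem (cramerPart_mem_span y₀ g I s y)
      (Submodule.smul_mem _ _ (hg.polarFibre_le_span hdisj hy hdet hu₁))) ?_)
  rw [hsum]
  exact sub_mem (Submodule.smul_mem _ _ (hg.symm.polarFibre_le_span hdisj.symm hy hdet hu₂))
    (cramerPart_mem_span y₀ g Iᶜ s y)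

variable {M : Type*} [TopologicalSpace M] [ChartedSpace (ℂ^n) M] [IsManifold (modelC n) ω M]

/-- Off the zeros of the two determinants this says `δ⁻¹ A₁ = J P J⁻¹ s`, where `A₁` is the Cramer
part in `W₁` and `P` the projection upstairs. -/
theorem IsAdaptedFrame.det_jacobian_smul_cramerPart (hg : IsAdaptedFrame W₁ W₂ y₀ V I g)
    (hdisj : W₁.IsDisjoint W₂) (s : Π y, TanC n N y) {η : M → N} {x₀ x : M}
    (hx : x ∈ chartDomain n x₀) (hxV : η x ∈ V)
    (hJ : (jacobian (m := n) (n := n) η x₀ y₀ x).det ≠ 0)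
    (hδ : (frameMap y₀ g (η x)).det ≠ 0) {P : ℂ^n →L[ℂ] ℂ^n}
    (hP₁ : ∀ v, mfderiv (modelC n) (modelC n) η x (ofCoord x₀ x (P v)) ∈ polarFibre W₁ (η x))
    (hP₂ : ∀ v, mfderiv (modelC n) (modelC n) η x (ofCoord x₀ x (v - P v)) ∈
      polarFibre W₂ (η x)) :
    (jacobian (m := n) (n := n) η x₀ y₀ x).det •
        (frameMap y₀ g (η x)).det⁻¹ • toCoord y₀ (η x) (cramerPart y₀ g I s (η x)) =
      jacobian (m := n) (n := n) η x₀ y₀ x (P (adjugate (jacobian (m := n) (n := n) η x₀ y₀ x)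
        (toCoord y₀ (η x) (s (η x))))) := by
  set J := jacobian (m := n) (n := n) η x₀ y₀ x with hJdef
  obtain ⟨w, hw⟩ := ((bijective_iff_det_ne_zero J).2 hJ).surjective (toCoord y₀ (η x) (s (η x)))
  let u (v : ℂ^n) : TanC n N (η x) := mfderiv (modelC n) (modelC n) η x (ofCoord x₀ x v)
  have hu : ∀ v, toCoord y₀ (η x) (u v) = J v := fun v => by
    rw [hJdef, ← jacobian_toCoord hx, toCoord_ofCoord hx]
  have hsu : s (η x) = u (P w) + u (w - P w) := by
    refine (toCoord_bijective (hg.le_chartDomain hxV)).injective ?_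
    rw [map_add, hu, hu, ← map_add, add_sub_cancel, hw]
  rw [hg.cramerPart_eq_det_smul hdisj hxV hδ (hP₁ w) (hP₂ w) hsu, map_smul, inv_smul_smul₀ hδ,
    ← hw, adjugate_apply_self, map_smul, map_smul, hu]

theorem IsAdaptedFrame.exists_norm_det_jacobian_mul_le (hg : IsAdaptedFrame W₁ W₂ y₀ V I g)
    {η : M → N} (hη : ContMDiff (modelC n) (modelC n) ω η)
    (h : (lifting (m := n) η W₁).IsDirectSum (lifting (m := n) η W₂))
    (hdisj : W₁.IsDisjoint W₂) {s : Π y, TanC n N y} (hs : IsHolField V s) {x₀ : M}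
    (hx₀ : η x₀ ∈ V) :
    ∃ C : ℝ, ∀ᶠ x in 𝓝 x₀, ‖(jacobian (m := n) (n := n) η x₀ y₀ x).det‖ *
      ‖(frameMap y₀ g (η x)).det⁻¹ • toCoord y₀ (η x) (cramerPart y₀ g I s (η x))‖ ≤ C := by
  have hV := hg.le_chartDomain
  obtain ⟨p, hp, hpW⟩ := h.exists_continuousOn_projection x₀
  have hx₀s := (chartDomain n x₀).isOpen.mem_nhds (mem_chartDomain_self x₀)
  let J := jacobian (m := n) (n := n) η x₀ y₀
  let F : M → ℂ^n := fun x => J x (p x (adjugate (J x) (toCoord y₀ (η x) (s (η x)))))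
  have hF : ContinuousAt F x₀ := by
    have hJ : ContinuousAt J x₀ :=
      (contMDiffAt_jacobian hη (mem_chartDomain_self x₀) (hV hx₀)).continuousAt
    have hadj : Continuous (adjugate : (ℂ^n →L[ℂ] ℂ^n) → _) :=
      (contDiff_adjugate (k := 0)).continuous
    have hs₀ : ContinuousAt (fun y => toCoord y₀ y (s y)) (η x₀) :=
      ((isHolField_iff hV).1 hs).continuousOn.continuousAt (V.isOpen.mem_nhds hx₀)
    exact hJ.clm_apply ((hp.continuousAt hx₀s).clm_apply ((hadj.continuousAt.comp hJ).clm_apply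
      (ContinuousAt.comp (f := η) hs₀ hη.continuous.continuousAt)))
  refine ⟨‖F x₀‖ + 1, ?_⟩
  filter_upwards [hF.norm.eventually_lt_const (lt_add_one ‖F x₀‖), hx₀s,
    hη.continuous.continuousAt.eventually_mem (V.isOpen.mem_nhds hx₀)] with x hFx hx hxV
  rcases eq_or_ne (jacobian (m := n) (n := n) η x₀ y₀ x).det 0 with hJ | hJ
  · rw [hJ, norm_zero, zero_mul]
    positivity
  rcases eq_or_ne (frameMap y₀ g (η x)).det 0 with hδ | hδ
  · rw [hδ, inv_zero, zero_smul, norm_zero, mul_zero]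
    positivity
  rw [← norm_smul, hg.det_jacobian_smul_cramerPart hdisj s hx hxV hJ hδ
    (fun v => mfderiv_mem_polarFibre_of_mem_lifting hη (hpW v).1 hx)
    fun v => mfderiv_mem_polarFibre_of_mem_lifting hη (hpW v).2 hx]
  exact hFx.le

end CramerBound

section SquareIntegrability

open Filter Topology MeasureTheory

variable {n : ℕ} {M : Type*} [TopologicalSpace M] [ChartedSpace (ℂ^n) M]
  [IsManifold (modelC n) ω M] {N : Type*} [TopologicalSpace N] [ChartedSpace (ℂ^n) N]
  [IsManifold (modelC n) ω N] [MeasurableSpace (ℂ^n)] [BorelSpace (ℂ^n)] (μ : Measure (ℂ^n))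
  [μ.IsAddHaarMeasure] {η : M → N} {y₀ : N} {E : Type*} [NormedAddCommGroup E] {q : N → E}

theorem exists_lintegral_sq_image_lt_top (hη : ContMDiff (modelC n) (modelC n) ω η) {x₀ : M}
    (hx₀ : η x₀ ∈ chartDomain n y₀) {C : ℝ}
    (hC : ∀ᶠ x in 𝓝 x₀, ‖(jacobian (m := n) (n := n) η x₀ y₀ x).det‖ * ‖q (η x)‖ ≤ C) :
    ∃ B ∈ 𝓝 x₀, ∫⁻ w in extChartAt (modelC n) y₀ '' (η '' B),
      ‖q ((extChartAt (modelC n) y₀).symm w)‖ₑ ^ 2 ∂μ < ⊤ := by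
  let φ := extChartAt (modelC n) x₀
  let f := coordMap (m := n) (n := n) η x₀ y₀
  let J (z : ℂ^n) := jacobian (m := n) (n := n) η x₀ y₀ (φ.symm z)
  obtain ⟨r, hr, hball⟩ := Metric.eventually_nhds_iff_ball.1 <|
    Filter.Eventually.and (extChartAt_target_mem_nhds (I := modelC n) x₀) <|
      (tendsto_extChartAt_symm x₀).eventually <| hC.and <|
        hη.continuous.continuousAt.eventually_mem ((chartDomain n y₀).isOpen.mem_nhds hx₀)
  replace hball : ∀ z ∈ Metric.ball (φ x₀) r, z ∈ φ.target ∧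
      ‖(J z).det‖ * ‖q (η (φ.symm z))‖ ≤ C ∧ η (φ.symm z) ∈ chartDomain n y₀ := hball
  have hderiv : ∀ z ∈ Metric.ball (φ x₀) r, HasFDerivAt f (J z) z := fun z hz => by
    have := hasFDerivAt_coordMap hη (extChartAt_symm_mem_chartDomain (hball z hz).1)
      (hball z hz).2.2
    rwa [φ.right_inv (hball z hz).1] at this
  refine ⟨φ.source ∩ φ ⁻¹' Metric.ball (φ x₀) r, inter_mem (extChartAt_source_mem_nhds x₀)
    ((continuousAt_extChartAt x₀).preimage_mem_nhds (Metric.ball_mem_nhds _ hr)), ?_⟩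
  calc ∫⁻ w in extChartAt (modelC n) y₀ '' (η '' (φ.source ∩ φ ⁻¹' Metric.ball (φ x₀) r)),
        ‖q ((extChartAt (modelC n) y₀).symm w)‖ₑ ^ 2 ∂μ
      ≤ ∫⁻ w in f '' Metric.ball (φ x₀) r, ‖q ((extChartAt (modelC n) y₀).symm w)‖ₑ ^ 2 ∂μ := by
        refine lintegral_mono_set ?_
        rintro _ ⟨_, ⟨x, hx, rfl⟩, rfl⟩
        rw [← coe_chartDomain] at hx
        exact ⟨φ x, hx.2, coordMap_extChartAt η y₀ hx.1⟩
    _ ≤ ∫⁻ z in Metric.ball (φ x₀) r, ‖(J z).det‖ₑ ^ 2 *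
          ‖q ((extChartAt (modelC n) y₀).symm (f z))‖ₑ ^ 2 ∂μ :=
        lintegral_image_le_lintegral_norm_det_sq_mul μ measurableSet_ball hderiv _
    _ ≤ ∫⁻ _ in Metric.ball (φ x₀) r, ENNReal.ofReal C ^ 2 ∂μ := by
        refine setLIntegral_mono measurable_const fun z hz => ?_
        obtain ⟨-, hzC, hzy₀⟩ := hball z hz
        have hleft : (extChartAt (modelC n) y₀).symm (f z) = η (φ.symm z) :=
          extChartAt_left_inv hzy₀
        rw [hleft, ← mul_pow, ← ofReal_norm, ← ofReal_norm, ← ENNReal.ofReal_mul (norm_nonneg _)]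
        gcongr
    _ < ⊤ := by
        rw [setLIntegral_const]
        exact ENNReal.mul_lt_top (ENNReal.pow_lt_top ENNReal.ofReal_lt_top) measure_ball_lt_top

theorem exists_lintegral_sq_ne_top (hη : ContMDiff (modelC n) (modelC n) ω η)
    (hproper : IsProperMap η) (hsurj : Function.Surjective η) {V : Opens N} (hy₀ : y₀ ∈ V)
    (hV : V ≤ chartDomain n y₀)
    (hq : ∀ x₀, η x₀ ∈ V → ∃ C : ℝ, ∀ᶠ x in 𝓝 x₀,
      ‖(jacobian (m := n) (n := n) η x₀ y₀ x).det‖ * ‖q (η x)‖ ≤ C) :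
    ∃ S ∈ 𝓝 (extChartAt (modelC n) y₀ y₀),
      ∫⁻ w in S, ‖q ((extChartAt (modelC n) y₀).symm w)‖ₑ ^ 2 ∂μ ≠ ⊤ := by
  let ψ := extChartAt (modelC n) y₀
  have : LocallyCompactSpace N := Manifold.locallyCompact_of_finiteDimensional (modelC n)
  obtain ⟨K, hK, hKV, hKc⟩ := local_compact_nhds (V.isOpen.mem_nhds hy₀)
  have hfin : ∫⁻ w in ψ '' (η '' (η ⁻¹' K)), ‖q (ψ.symm w)‖ₑ ^ 2 ∂μ < ⊤ := by
    refine (hproper.isCompact_preimage hKc).induction_on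
      (p := fun B => ∫⁻ w in ψ '' (η '' B), ‖q (ψ.symm w)‖ₑ ^ 2 ∂μ < ⊤) (by simp) ?_ ?_ ?_
    · exact fun B B' hB hB' =>
        (lintegral_mono_set (Set.image_mono (Set.image_mono hB))).trans_lt hB'
    · intro B B' hB hB'
      rw [Set.image_union, Set.image_union]
      exact (lintegral_union_le _ _ _).trans_lt (ENNReal.add_lt_top.2 ⟨hB, hB'⟩)
    · intro x hx
      obtain ⟨C, hC⟩ := hq x (hKV hx)
      obtain ⟨B, hB, hBfin⟩ := exists_lintegral_sq_image_lt_top μ hη (hV (hKV hx)) hC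
      exact ⟨B, mem_nhdsWithin_of_mem_nhds hB, hBfin⟩
  rw [Set.image_preimage_eq _ hsurj] at hfin
  refine ⟨ψ '' K, ?_, hfin.ne⟩
  filter_upwards [tendsto_extChartAt_symm y₀ hK, extChartAt_target_mem_nhds y₀] with w hw hwt
  exact ⟨ψ.symm w, hw, ψ.right_inv hwt⟩

end SquareIntegrability

section MeromorphicDivision

open Filter Topology MeasureTheory

variable {n : ℕ} {N : Type*} [TopologicalSpace N] [ChartedSpace (ℂ^n) N]
  {y₀ : N}

theorem NowhereLocallyZero.not_eventually_comp_extChartAt_symm_eq_zero {V : Opens N} {δ : N → ℂ}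
    (hδ : NowhereLocallyZero V δ) (hy₀ : y₀ ∈ V) :
    ¬ ∀ᶠ z in 𝓝 (extChartAt (modelC n) y₀ y₀), δ ((extChartAt (modelC n) y₀).symm z) = 0 := by
  intro hzero
  have hzero' : ∀ᶠ y in 𝓝 y₀, δ y = 0 := by
    filter_upwards [(continuousAt_extChartAt (I := modelC n) y₀).eventually hzero,
      (chartDomain n y₀).isOpen.mem_nhds (mem_chartDomain_self y₀)] with y hy hys
    rwa [extChartAt_left_inv hys] at hy
  obtain ⟨T, hT, hTo, hyT⟩ := eventually_nhds_iff.1 (hzero'.and (V.isOpen.mem_nhds hy₀))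
  obtain ⟨y, hy, hne⟩ := hδ ⟨T, hTo⟩ (fun y hy => (hT y hy).2) ⟨y₀, hyT⟩
  exact hne (hT y hy).1

variable [IsManifold (modelC n) ω N]

theorem exists_isHolField_smul_eq_of_lintegral_sq_ne_top [MeasurableSpace (ℂ^n)]
    [BorelSpace (ℂ^n)] (μ : Measure (ℂ^n)) [μ.IsAddHaarMeasure] {V : Opens N} (hy₀ : y₀ ∈ V)
    (hV : V ≤ chartDomain n y₀) {δ : N → ℂ} (hδ : IsHolFun (n := n) V δ)
    (hδ₀ : NowhereLocallyZero V δ) {A : Π y, TanC n N y} (hA : IsHolField V A) {S : Set (ℂ^n)}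
    (hS : S ∈ 𝓝 (extChartAt (modelC n) y₀ y₀))
    (hL : ∫⁻ w in S, ‖(fun y => (δ y)⁻¹ • toCoord y₀ y (A y))
      ((extChartAt (modelC n) y₀).symm w)‖ₑ ^ 2 ∂μ ≠ ⊤) :
    ∃ V' ≤ V, y₀ ∈ V' ∧ ∃ s : Π y, TanC n N y, IsHolField V' s ∧ ∀ y ∈ V', δ y • s y = A y := by
  let ψ := extChartAt (modelC n) y₀
  have hVnhds := V.isOpen.mem_nhds hy₀
  have hy₀' := mem_chartDomain_self (n := n) y₀
  obtain ⟨B, hB, hAB⟩ := exists_analyticAt_eq_smul_of_lintegral_sq μ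
    (a := fun z => toCoord y₀ (ψ.symm z) (A (ψ.symm z))) (d := δ ∘ ψ.symm)
    (analyticAt_comp_extChartAt_symm hy₀' (((isHolField_iff hV).1 hA).contMDiffAt hVnhds))
    (analyticAt_comp_extChartAt_symm hy₀' (hδ.contMDiffAt hVnhds))
    (hδ₀.not_eventually_comp_extChartAt_symm_eq_zero hy₀) hS hL
  have hψ : ContinuousAt ψ y₀ := continuousAt_extChartAt y₀
  obtain ⟨T, hT, hTo, hyT⟩ := eventually_nhds_iff.1 <| (V.isOpen.eventually_mem hy₀).and <|
    (hψ.eventually hB.eventually_analyticAt).and (hψ.eventually hAB)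
  have hTV : (⟨T, hTo⟩ : Opens N) ≤ V := fun y hy => (hT y hy).1
  refine ⟨⟨T, hTo⟩, hTV, hyT, fun y => ofCoord y₀ y (B (ψ y)),
    (isHolField_iff (hTV.trans hV)).2 ?_, fun y hy => ?_⟩
  · have hcomp : ContMDiffOn (modelC n) (modelC n) ω (B ∘ ψ) T := fun y hy =>
      (contMDiffAt_comp_extChartAt (hV (hTV hy)) (hT y hy).2.1).contMDiffWithinAt
    exact hcomp.congr fun y hy => toCoord_ofCoord (hV (hTV hy)) _
  · refine (toCoord_bijective (hV (hTV hy))).injective ?_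
    have := (hT y hy).2.2
    rw [Function.comp_apply, extChartAt_left_inv (hV (hTV hy))] at this
    rw [map_smul, toCoord_ofCoord (hV (hTV hy)), this]

end MeromorphicDivision

section LocalDecomposition

open MeasureTheory

variable {n : ℕ} {M : Type*} [TopologicalSpace M] [ChartedSpace (ℂ^n) M]
  [IsManifold (modelC n) ω M] {N : Type*} [TopologicalSpace N] [ChartedSpace (ℂ^n) N]
  [IsManifold (modelC n) ω N]

theorem IsAdaptedFrame.exists_add_eq_of_smul_eq_cramerPart {W₁ W₂ : TangentSubsheaf n N}
    (hW₁ : W₁.IsSaturated) (hW₂ : W₂.IsSaturated) {y₀ : N} {V : Opens N} {I : Finset (Fin n)}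
    {g : Fin n → Π y, TanC n N y} (hg : IsAdaptedFrame W₁ W₂ y₀ V I g)
    {s s₁ : Π y, TanC n N y} (hs : IsHolField V s) (hs₁ : IsHolField V s₁)
    (hdiv : ∀ y ∈ V, (frameMap y₀ g y).det • s₁ y = cramerPart y₀ g I s y) :
    ∃ s₁ ∈ W₁.sec V, ∃ s₂ ∈ W₂.sec V, ∀ y ∈ V, s y = s₁ y + s₂ y := by
  refine ⟨s₁, hW₁ V _ s₁ hg.isHolFun_det hg.nowhereLocallyZero_det hs₁
    (W₁.congr_mem (hg.cramerPart_mem hs) hdiv), fun y => s y - s₁ y, ?_,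
    fun y _ => (add_sub_cancel _ _).symm⟩
  have hs₂ : IsHolField V fun y => s y - s₁ y := by
    rw [isHolField_iff hg.le_chartDomain] at hs hs₁ ⊢
    simpa only [map_sub] using hs.sub hs₁
  refine hW₂ V _ _ hg.isHolFun_det hg.nowhereLocallyZero_det hs₂
    (W₂.congr_mem (hg.symm.cramerPart_mem hs) fun y hy => ?_)
  rw [smul_sub, hdiv y hy, ← cramerPart_add_cramerPart_compl (I := I) (hg.le_chartDomain hy) s,
    add_sub_cancel_left]

theorem exists_local_decomposition {η : M → N} (hη : ContMDiff (modelC n) (modelC n) ω η)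
    (hproper : IsProperMap η) (hsurj : Function.Surjective η) {W₁ W₂ : TangentSubsheaf n N}
    (hW₁ : IsDistribution W₁) (hW₂ : IsDistribution W₂)
    (h : (lifting (m := n) η W₁).IsDirectSum (lifting (m := n) η W₂)) {O : Opens N}
    {s : Π y, TanC n N y} (hs : IsHolField O s) {y₀ : N} (hy₀ : y₀ ∈ O) :
    ∃ V ≤ O, y₀ ∈ V ∧ ∃ s₁ ∈ W₁.sec V, ∃ s₂ ∈ W₂.sec V, ∀ y ∈ V, s y = s₁ y + s₂ y := by
  have hdisj : W₁.IsDisjoint W₂ := isDisjoint_of_lifting hη hproper hsurj h.isDisjoint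
  have hsup (O : Opens N) (hO : (O : Set N).Nonempty) :
      ∃ y ∈ O, polarFibre W₁ y ⊔ polarFibre W₂ y = ⊤ := by
    obtain ⟨x, hx, hxs⟩ := exists_surjective_mfderiv le_rfl hη hproper hsurj hO
    exact ⟨η x, hx, polarFibre_sup_polarFibre_eq_top hη h hxs⟩
  obtain ⟨V, hVO, hy₀V, I, g, hg⟩ := exists_isAdaptedFrame hW₁.1 hW₂.1 hsup hy₀
  replace hs := hs.mono hVO
  let q (y : N) : ℂ^n := (frameMap y₀ g y).det⁻¹ • toCoord y₀ y (cramerPart y₀ g I s y)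
  let μ : Measure (ℂ^n) := Measure.addHaar
  obtain ⟨S, hS, hL⟩ := exists_lintegral_sq_ne_top μ hη hproper hsurj hy₀V hg.le_chartDomain
    (q := q) fun x₀ hx₀ => hg.exists_norm_det_jacobian_mul_le hη h hdisj hs hx₀
  obtain ⟨V', hV', hy₀V', s₁, hs₁, hdiv⟩ :=
    exists_isHolField_smul_eq_of_lintegral_sq_ne_top μ hy₀V hg.le_chartDomain hg.isHolFun_det
      hg.nowhereLocallyZero_det (W₁.isHol (hg.cramerPart_mem hs)) hS hL
  exact ⟨V', hV'.trans hVO, hy₀V', (hg.mono hV').exists_add_eq_of_smul_eq_cramerPart hW₁.2 hW₂.2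
    (hs.mono hV') hs₁ hdiv⟩

end LocalDecomposition

theorem lemma3p5_general {m n : ℕ}
    {U' : Type*} [TopologicalSpace U'] [ChartedSpace (ℂ^m) U'] [IsManifold (modelC m) ω U']
    {U : Type*} [TopologicalSpace U] [ChartedSpace (ℂ^n) U] [IsManifold (modelC n) ω U]
    {η : U' → U} (hη : IsFiniteSurjective m n η)
    {W₁ W₂ : TangentSubsheaf n U} (hW₁ : IsDistribution W₁) (hW₂ : IsDistribution W₂)
    (h : (lifting (m := m) η W₁).IsDirectSum (lifting (m := m) η W₂)) :
    W₁.IsDirectSum W₂ := by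
  obtain hU' | hU' := isEmpty_or_nonempty U'
  · have : IsEmpty U := hη.surjective.isEmpty
    exact fun V => ⟨fun s _ => ⟨0, W₁.zero_mem V, 0, W₂.zero_mem V, fun y => isEmptyElim y⟩,
      fun s _ y => isEmptyElim y⟩
  · obtain rfl : m = n := hη.dim_eq
    have hdisj : W₁.IsDisjoint W₂ :=
      isDisjoint_of_lifting hη.isHol hη.isProper hη.surjective h.isDisjoint
    exact hdisj.isDirectSum_of_locally fun V s hs x hx =>
      exists_local_decomposition hη.isHol hη.isProper hη.surjective hW₁ hW₂ h hs hx

theorem lemma3p5 {m n : ℕ}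
    {U' : Type*} [TopologicalSpace U'] [T2Space U'] [SecondCountableTopology U']
    [ConnectedSpace U'] [ChartedSpace (EuclideanSpace ℂ (Fin m)) U'] [IsManifold (modelC m) ω U']
    {U : Type*} [TopologicalSpace U] [T2Space U] [SecondCountableTopology U]
    [ConnectedSpace U] [ChartedSpace (EuclideanSpace ℂ (Fin n)) U] [IsManifold (modelC n) ω U]
    (η : U' → U) (hη : IsFiniteSurjective m n η)
    (W₁ W₂ : TangentSubsheaf n U) (hW₁ : IsDistribution W₁) (hW₂ : IsDistribution W₂)
    (h : (lifting (m := m) η W₁).IsDirectSum (lifting (m := m) η W₂)) :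
    W₁.IsDirectSum W₂ :=
  lemma3p5_general hη hW₁ hW₂ h
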